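/- Let $n\ge 3$ and let $G=(V,E)$ be an undirected simple graph with $V=\{1,\dots,n\}$; let $K$ be the complete graph on $V$. A framework $(G,p)$ consists of $G$ and a configuration $p=(p_1,\dots,p_n)$ of pairwise distinct points of $\mathbb{R}^2$; it is non-degenerate if the points $p_i$ are not all on one line. For an edge $(j,i)$ let $b_{ji}(p)=\frac{p_i-p_j}{\|p_i-p_j\|}$, and for edges $(j,i),(j,k)$ with $i<k$ let $\alpha_{ijk}(p)\in[0,2\pi)$ be the counter-clockwise angle from $b_{ji}(p)$ to $b_{jk}(p)$. Let $B_G(p)$ be the family of all $b_{ji}(p)$, $(j,i)\in E$, and $S_G(p)$ the family of all these angles $\alpha_{ijk}(p)$; they are defined where adjacent vertices have distinct positions. For $r=B$ (respectively $r=S$), a framework $(G,p)$ is bearing rigid, BR (respectively signed angle rigid, SAR), if $p$ has a neighbourhood $U$ such that $r_K(q)=r_K(p)$ for every $q\in U\cap r_G^{-1}(r_G(p))$; it is globally bearing rigid, GBR (respectively globally signed angle rigid, GSAR), if $r_G^{-1}(r_G(p))=r_K^{-1}(r_K(p))$. Write $x^\perp$ for $x$ rotated by $+\pi/2$ and $P(b)=I-bb^\top$.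 The framework is infinitesimally bearing rigid, IBR, if every $v\in(\mathbb{R}^2)^n$ with $\frac{1}{\|p_i-p_j\|}P(b_{ji})(v_i-v_j)=0$ for all $(j,i)\in E$ is a linear combination of $p$ and translations $(\xi,\dots,\xi)$. It is infinitesimally signed angle rigid, ISAR, if every $v$ with $\frac{b_{ji}^\top (v_i-v_j)^\perp}{\|p_i-p_j\|}=\frac{b_{jk}^\top (v_k-v_j)^\perp}{\|p_k-p_j\|}$ for all $(j,i),(j,k)\in E$ with $i<k$ is a linear combination of $p$, $(p_1^\perp,\dots,p_n^\perp)$ and translations. A graph is ISAR or IBR if some framework on it has this property; it is SAR, GSAR, BR or GBR if some non-degenerate framework on it has this property. A spanning subgraph of $G$ is a connected subgraph with vertex set $V$. For each $X$ among SAR, ISAR, GSAR, IBR, GBR, BR, the graph $G$ is minimally $X$ if $G$ is $X$ and no spanning subgraph of $G$ with fewer edges is $X$. A framework $(G,p)$ that is $X$ (and, for SAR, GSAR, GBR and BR, non-degenerate) is minimally $X$ if for no spanning subgraph $H$ of $G$ with fewer edges $(H,p)$ is $X$. The graph $G$ is a Laman graph if $|E|=2n-3$ and $e\le 2v-3$ for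 every subgraph of $G$ with $v\ge 2$ vertices and $e$ edges. Theorem. For each $X\in\{\text{SAR},\text{ISAR},\text{GSAR},\text{IBR},\text{GBR},\text{BR}\}$: $G$ is minimally $X$ if and only if $G$ is a Laman graph. Likewise, there is a configuration $p$ such that the framework $(G,p)$ is minimally $X$ if and only if $G$ is a Laman graph. -/

import Mathlib

open Topology

noncomputable section

namespace PlanarRigidity

/-- The Euclidean plane. -/
abbrev Plane : Type := EuclideanSpace ℝ (Fin 2)

/-- Configurations of `n` points in the plane; also used for velocity assignments. -/
abbrev Config (n : ℕ) : Type := Fin n → Plane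

/-- The counter-clockwise rotation by `π / 2`. -/
def perp (x : Plane) : Plane := !₂[-x 1, x 0]

/-- The points of the configuration do not lie on one line. -/
def IsNondegenerate {n : ℕ} (p : Config n) : Prop := ¬ Collinear ℝ (Set.range p)

/-! ### Bearings and signed angles -/

/-- The bearing `b_{ji}`, the unit vector from `p j` to `p i`. -/
def bearing {n : ℕ} (p : Config n) (j i : Fin n) : Plane :=
  ‖p i - p j‖⁻¹ • (p i - p j)

/-- The signed angle `α_{ijk} ∈ [0, 2π)` from `b_{ji}` to `b_{jk}`, counter-clockwise. -/
def signedAngle {n : ℕ} (p : Config n) (i j k : Fin n) : ℝ :=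
  if 0 ≤ inner ℝ (bearing p j k) (perp (bearing p j i)) then
    Real.arccos (inner ℝ (bearing p j k) (bearing p j i))
  else
    2 * Real.pi - Real.arccos (inner ℝ (bearing p j k) (bearing p j i))

/-- The (ordered) edges `(j, i)` of a graph. -/
abbrev EdgeIndex {n : ℕ} (G : SimpleGraph (Fin n)) : Type :=
  {e : Fin n × Fin n // G.Adj e.1 e.2}

/-- The triples `(i, j, k)` with edges `(j, i)`, `(j, k)` and `i < k`. -/
abbrev AngleIndex {n : ℕ} (G : SimpleGraph (Fin n)) : Type :=
  {t : Fin n × Fin n × Fin n // G.Adj t.2.1 t.1 ∧ G.Adj t.2.1 t.2.2 ∧ t.1 < t.2.2}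

/-- The bearing rigidity function `B_G`. -/
def bearingFun {n : ℕ} (G : SimpleGraph (Fin n)) (p : Config n) : EdgeIndex G → Plane :=
  fun e => bearing p e.1.1 e.1.2

/-- The signed angle rigidity function `S_G`. -/
def signedAngleFun {n : ℕ} (G : SimpleGraph (Fin n)) (p : Config n) : AngleIndex G → ℝ :=
  fun t => signedAngle p t.1.1 t.1.2.1 t.1.2.2

/-! ### Rigidity and global rigidity with respect to a rigidity function -/

/-- The fibre `r_G⁻¹(r_G(p))`. Bearings and signed angles of `G` are defined at those
configurations in which adjacent vertices have distinct positions. -/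
def fibre {n : ℕ} {C : SimpleGraph (Fin n) → Type}
    (r : (G : SimpleGraph (Fin n)) → Config n → C G)
    (G : SimpleGraph (Fin n)) (p : Config n) : Set (Config n) :=
  {q | (∀ i j, G.Adj i j → q i ≠ q j) ∧ r G q = r G p}

/-- Rigidity of the framework `(G, p)`; the complete graph is `⊤`. -/
def IsRigid {n : ℕ} {C : SimpleGraph (Fin n) → Type}
    (r : (G : SimpleGraph (Fin n)) → Config n → C G)
    (G : SimpleGraph (Fin n)) (p : Config n) : Prop :=
  ∃ U ∈ 𝓝 p, ∀ q ∈ fibre r G p ∩ U, r ⊤ q = r ⊤ p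

/-- Global rigidity of the framework `(G, p)`. -/
def IsGloballyRigid {n : ℕ} {C : SimpleGraph (Fin n) → Type}
    (r : (G : SimpleGraph (Fin n)) → Config n → C G)
    (G : SimpleGraph (Fin n)) (p : Config n) : Prop :=
  fibre r G p = fibre r ⊤ p

/-- `(G, p)` is bearing rigid. -/
def IsBR {n : ℕ} (G : SimpleGraph (Fin n)) (p : Config n) : Prop :=
  IsRigid bearingFun G p

/-- `(G, p)` is globally bearing rigid. -/
def IsGBR {n : ℕ} (G : SimpleGraph (Fin n)) (p : Config n) : Prop :=
  IsGloballyRigid bearingFun G p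

/-- `(G, p)` is signed angle rigid. -/
def IsSAR {n : ℕ} (G : SimpleGraph (Fin n)) (p : Config n) : Prop :=
  IsRigid signedAngleFun G p

/-- `(G, p)` is globally signed angle rigid. -/
def IsGSAR {n : ℕ} (G : SimpleGraph (Fin n)) (p : Config n) : Prop :=
  IsGloballyRigid signedAngleFun G p

/-! ### Infinitesimal rigidity -/

/-- The bearing rigidity matrix applied to the velocity `v`: its block for the edge `(j, i)`
is `P(b_{ji}) (v i - v j) / ‖p i - p j‖` with `P(b) = I - b bᵀ`. -/
def bearingRigidityMap {n : ℕ} (G : SimpleGraph (Fin n)) (p v : Config n) :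
    EdgeIndex G → Plane :=
  fun e =>
    let j := e.1.1
    let i := e.1.2
    ‖p i - p j‖⁻¹ •
      ((v i - v j) - (inner ℝ (bearing p j i) (v i - v j) : ℝ) • bearing p j i)

/-- The signed angle rigidity matrix applied to the velocity `v`: its row for `(i, j, k)` is
the derivative of the signed angle, in the form that is also valid where `sin α_{ijk} = 0`. -/
def signedAngleRigidityMap {n : ℕ} (G : SimpleGraph (Fin n)) (p v : Config n) :
    AngleIndex G → ℝ :=
  fun t =>
    let i := t.1.1
    let j := t.1.2.1
    let k := t.1.2.2
    ‖p i - p j‖⁻¹ * inner ℝ (bearing p j i) (perp (v i - v j))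
      - ‖p k - p j‖⁻¹ * inner ℝ (bearing p j k) (perp (v k - v j))

/-- The trivial infinitesimal bearing motions: translations and scalings. -/
def trivialBearingMotions {n : ℕ} (p : Config n) : Submodule ℝ (Config n) :=
  Submodule.span ℝ ({p} ∪ Set.range (fun (ξ : Plane) (_ : Fin n) => ξ))

/-- The trivial infinitesimal signed angle motions: translations, scalings and rotations. -/
def trivialSignedAngleMotions {n : ℕ} (p : Config n) : Submodule ℝ (Config n) :=
  Submodule.span ℝ
    ({p} ∪ {fun i => perp (p i)} ∪ Set.range (fun (ξ : Plane) (_ : Fin n) => ξ))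

/-- `(G, p)` is infinitesimally bearing rigid. -/
def IsIBR {n : ℕ} (G : SimpleGraph (Fin n)) (p : Config n) : Prop :=
  ∀ v : Config n, bearingRigidityMap G p v = 0 → v ∈ trivialBearingMotions p

/-- `(G, p)` is infinitesimally signed angle rigid. -/
def IsISAR {n : ℕ} (G : SimpleGraph (Fin n)) (p : Config n) : Prop :=
  ∀ v : Config n, signedAngleRigidityMap G p v = 0 → v ∈ trivialSignedAngleMotions p

/-! ### Rigid graphs, minimal rigidity, Laman graphs -/

/-- The restriction of a property of frameworks to the non-degenerate ones. -/
def OnNondegenerate {n : ℕ} (Rigid : SimpleGraph (Fin n) → Config n → Prop)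
    (G : SimpleGraph (Fin n)) (p : Config n) : Prop :=
  IsNondegenerate p ∧ Rigid G p

/-- `H` is a spanning subgraph of `G`: connected, on all vertices of `G`. -/
def IsSpanningSubgraph {n : ℕ} (H G : SimpleGraph (Fin n)) : Prop :=
  H ≤ G ∧ H.Connected

/-- The framework `(G, p)` is minimally rigid: it is a framework (the points are pairwise
distinct), it is rigid, and no rigid spanning subframework has fewer edges. -/
def IsMinimallyRigidFramework {n : ℕ} (Rigid : SimpleGraph (Fin n) → Config n → Prop)
    (G : SimpleGraph (Fin n)) (p : Config n) : Prop :=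
  Function.Injective p ∧ Rigid G p ∧
    ¬ ∃ H : SimpleGraph (Fin n), IsSpanningSubgraph H G ∧ Rigid H p ∧
      H.edgeSet.ncard < G.edgeSet.ncard

/-- The graph `G` is rigid: some framework on it is rigid. -/
def IsRigidGraph {n : ℕ} (Rigid : SimpleGraph (Fin n) → Config n → Prop)
    (G : SimpleGraph (Fin n)) : Prop :=
  ∃ p : Config n, Function.Injective p ∧ Rigid G p

/-- The graph `G` is minimally rigid: it is rigid, and no rigid spanning subgraph has fewer
edges. -/
def IsMinimallyRigidGraph {n : ℕ} (Rigid : SimpleGraph (Fin n) → Config n → Prop)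
    (G : SimpleGraph (Fin n)) : Prop :=
  IsRigidGraph Rigid G ∧
    ¬ ∃ H : SimpleGraph (Fin n), IsSpanningSubgraph H G ∧ IsRigidGraph Rigid H ∧
      H.edgeSet.ncard < G.edgeSet.ncard

/-- Laman graphs: `2n - 3` edges in all, and `e ≤ 2v - 3` for every subgraph with `v ≥ 2`
vertices and `e` edges. -/
def IsLamanGraph {n : ℕ} (G : SimpleGraph (Fin n)) : Prop :=
  3 ≤ n ∧ G.edgeSet.ncard + 3 = 2 * n ∧
    ∀ H : G.Subgraph, 2 ≤ H.verts.ncard → H.edgeSet.ncard + 3 ≤ 2 * H.verts.ncard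

end PlanarRigidity

end

open PlanarRigidity

/-! For at least three distinct points the six notions (four of them with non-degeneracy) coincide
with infinitesimal bearing rigidity (`isIBR_tfae`). An infinitesimal bearing motion is a velocity
`v` whose difference along each edge is parallel to that edge. This condition is linear, so `p + ε •
v` has exactly the same bearings on `G` for small `ε`; hence local rigidity forces `v` to be
trivial. Conversely, a configuration with the bearings of `p` up to a rotation becomes, once rotated
back, an element of the kernel at `p`, so under IBR it is similar to `p`. Signed angles reduce to
bearings because equality of angles around each vertex carries a single rotation, or a single
angular velocity, along a connected graph.

The rest is counting. Trivial bearing motions have dimension 3 in a space of dimension `2 * n`, so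
IBR means that the edge rows have rank `2 * n - 3`. Independent rows on a vertex set `X` number at
most `2 * X.card - 3` (`card_add_three_le`), so a row basis is a rigid Laman subgraph, and
minimality makes it all of `G`. The converse is Laman's theorem (`Sparse.exists_linearIndepOn`), by
Henneberg induction: a sparse edge set has a vertex of degree 1, 2 or 3. In degree at most 2 the
vertex can be attached freely. In degree 3 its edges are traded for one edge between two neighbours,
and the trade is undone by placing the vertex at the midpoint of that edge and perturbing. A Laman
graph is then minimal because every IBR framework, at any configuration, has at least `2 * n - 3`
edges. -/

namespace PlanarRigidity

/-! ### Plane vectors, rotations and bearings -/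

/-- The cross product (signed area) of two plane vectors. -/
noncomputable def cross (x y : Plane) : ℝ := x 0 * y 1 - x 1 * y 0

/-- The linear map `x ↦ c x + s x^⊥`; a rotation when `c ^ 2 + s ^ 2 = 1`. -/
noncomputable def rot (c s : ℝ) (x : Plane) : Plane := c • x + s • perp x

theorem plane_ext {x y : Plane} (h0 : x 0 = y 0) (h1 : x 1 = y 1) : x = y := by
  ext i; fin_cases i <;> assumption

@[simp] theorem perp_zero_coord (x : Plane) : perp x 0 = -x 1 := rfl
@[simp] theorem perp_one_coord (x : Plane) : perp x 1 = x 0 := rfl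
@[simp] theorem rot_zero_coord (c s : ℝ) (x : Plane) : rot c s x 0 = c * x 0 - s * x 1 := by
  simp [rot]; ring
@[simp] theorem rot_one_coord (c s : ℝ) (x : Plane) : rot c s x 1 = c * x 1 + s * x 0 := by
  simp [rot]

theorem inner_coord (x y : Plane) : (inner ℝ x y : ℝ) = x 0 * y 0 + x 1 * y 1 := by
  simp [PiLp.inner_apply, Fin.sum_univ_two]; ring

theorem norm_sq_coord (x : Plane) : ‖x‖ ^ 2 = x 0 ^ 2 + x 1 ^ 2 := by
  rw [← real_inner_self_eq_norm_sq, inner_coord]; ring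

theorem inner_perp (x y : Plane) : (inner ℝ x (perp y) : ℝ) = cross y x := by
  simp [inner_coord, cross]; ring

/-- Two vectors with vanishing cross product, the first nonzero, are proportional. -/
theorem exists_smul_of_cross_eq_zero {x y : Plane} (hx : x ≠ 0) (h : cross x y = 0) :
    ∃ c : ℝ, y = c • x := by
  have hn : x 0 ^ 2 + x 1 ^ 2 ≠ 0 := by
    rw [← norm_sq_coord]; exact pow_ne_zero 2 (norm_ne_zero_iff.2 hx)
  unfold cross at h
  -- The coefficient of the orthogonal projection of `y` onto `x`.
  refine ⟨(x 0 * y 0 + x 1 * y 1) / (x 0 ^ 2 + x 1 ^ 2), plane_ext ?_ ?_⟩ <;>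
    simp <;> field_simp
  · linear_combination (-x 1) * h
  · linear_combination (x 0) * h

/-- A vector parallel to two independent vectors vanishes. -/
theorem eq_zero_of_cross_eq_zero {x y z : Plane} (h : cross x y ≠ 0) (hx : cross x z = 0)
    (hy : cross y z = 0) : z = 0 := by
  unfold cross at *
  refine plane_ext ?_ ?_ <;> simp <;> refine (mul_eq_zero.1 ?_).resolve_left h
  · linear_combination (y 0) * hx - (x 0) * hy
  · linear_combination (y 1) * hx - (x 1) * hy

variable {n : ℕ} {G : SimpleGraph (Fin n)} {p q v : Config n}

theorem norm_smul_bearing {p : Config n} {j i : Fin n} (h : p i ≠ p j) :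
    ‖p i - p j‖ • bearing p j i = p i - p j := by
  rw [bearing, smul_smul, mul_inv_cancel₀ (norm_ne_zero_iff.2 (sub_ne_zero.2 h)), one_smul]

theorem norm_bearing {p : Config n} {j i : Fin n} (h : p i ≠ p j) : ‖bearing p j i‖ = 1 := by
  rw [bearing, norm_smul, norm_inv, norm_norm,
    inv_mul_cancel₀ (norm_ne_zero_iff.2 (sub_ne_zero.2 h))]

theorem bearing_sq {p : Config n} {j i : Fin n} (h : p i ≠ p j) :
    bearing p j i 0 ^ 2 + bearing p j i 1 ^ 2 = 1 := by
  rw [← norm_sq_coord, norm_bearing h]; norm_num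

theorem bearing_swap (p : Config n) (i j : Fin n) : bearing p i j = -bearing p j i := by
  rw [bearing, bearing, norm_sub_rev, ← smul_neg, neg_sub]

theorem norm_rot {c s : ℝ} (h : c ^ 2 + s ^ 2 = 1) (x : Plane) : ‖rot c s x‖ = ‖x‖ := by
  have : ‖rot c s x‖ ^ 2 = ‖x‖ ^ 2 := by
    rw [norm_sq_coord, norm_sq_coord]; simp
    linear_combination (x 0 ^ 2 + x 1 ^ 2) * h
  exact (sq_eq_sq₀ (norm_nonneg _) (norm_nonneg _)).1 this

/-- If the difference vectors correspond under a rotation and a positive scaling, so do the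
bearings. -/
theorem bearing_eq_rot {c s t : ℝ} (h : c ^ 2 + s ^ 2 = 1) (ht : 0 < t) {j i : Fin n}
    (hq : q i - q j = t • rot c s (p i - p j)) : bearing q j i = rot c s (bearing p j i) := by
  rw [bearing, hq, norm_smul, norm_rot h, Real.norm_of_nonneg ht.le, bearing, mul_inv,
    smul_smul]
  have : t⁻¹ * ‖p i - p j‖⁻¹ * t = ‖p i - p j‖⁻¹ := by field_simp
  rw [this]
  refine plane_ext ?_ ?_ <;> simp <;> ring

theorem rot_one_zero (x : Plane) : rot 1 0 x = x := by simp [rot]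

theorem bearing_eq_of_pos_smul {t : ℝ} (ht : 0 < t) {j i : Fin n}
    (hq : q i - q j = t • (p i - p j)) : bearing q j i = bearing p j i := by
  have := bearing_eq_rot (p := p) (q := q) (c := 1) (s := 0) (by norm_num) ht
    (by rwa [rot_one_zero])
  rwa [rot_one_zero] at this

/-! ### The kernel of the bearing rigidity matrix -/

/-- The projection `P(b)` kills exactly the multiples of `b`. The cross product form is polynomial
in `p`, which the later perturbation arguments need. -/
theorem bearingRigidityMap_eq_zero_iff (hp : Function.Injective p) :
    bearingRigidityMap G p v = 0 ↔ ∀ i j, G.Adj i j → cross (p i - p j) (v i - v j) = 0 := by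
  have key : ∀ i j, i ≠ j → ((‖p i - p j‖⁻¹ • ((v i - v j) -
      (inner ℝ (bearing p j i) (v i - v j) : ℝ) • bearing p j i) = 0) ↔
      cross (p i - p j) (v i - v j) = 0) := by
    intro i j hij
    have hne : p i ≠ p j := fun h => hij (hp h)
    have hn : ‖p i - p j‖ ≠ 0 := norm_ne_zero_iff.2 (sub_ne_zero.2 hne)
    rw [smul_eq_zero, or_iff_right (inv_ne_zero hn), sub_eq_zero]
    constructor
    · intro h
      rw [h, bearing, smul_smul]
      simp [cross]; ring
    · intro h
      obtain ⟨c, hc⟩ := exists_smul_of_cross_eq_zero (sub_ne_zero.2 hne) h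
      rw [hc, bearing, inner_smul_left, inner_smul_right, real_inner_self_eq_norm_sq, smul_smul]
      congr 1
      simp
      field_simp
  constructor
  · intro h i j hij
    exact (key i j hij.ne).1 (congrFun h ⟨(j, i), hij.symm⟩)
  · intro h
    funext e
    exact (key e.1.2 e.1.1 e.2.ne').2 (h _ _ e.2.symm)

/-- Each quotient is the angular velocity of an edge, so the kernel consists of the velocities under
which all edges at a vertex turn equally fast. Symmetry removes the restriction `i < k`. -/
theorem signedAngleRigidityMap_eq_zero_iff :
    signedAngleRigidityMap G p v = 0 ↔ ∀ j i k, G.Adj j i → G.Adj j k →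
      cross (p i - p j) (v i - v j) / ‖p i - p j‖ ^ 2 =
        cross (p k - p j) (v k - v j) / ‖p k - p j‖ ^ 2 := by
  have key : ∀ i j, ‖p i - p j‖⁻¹ * inner ℝ (bearing p j i) (perp (v i - v j)) =
      -(cross (p i - p j) (v i - v j) / ‖p i - p j‖ ^ 2) := by
    intro i j
    rw [bearing, inner_smul_left, inner_perp]
    simp [cross]
    ring
  constructor
  · intro h j i k hi hk
    have : ∀ i k, G.Adj j i → G.Adj j k → i < k →
      cross (p i - p j) (v i - v j) / ‖p i - p j‖ ^ 2 =
        cross (p k - p j) (v k - v j) / ‖p k - p j‖ ^ 2 := by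
      intro i k hi hk hik
      have := congrFun h ⟨(i, j, k), hi, hk, hik⟩
      simp only [signedAngleRigidityMap, key, Pi.zero_apply] at this
      linarith
    rcases lt_trichotomy i k with hik | rfl | hik
    · exact this i k hi hk hik
    · rfl
    · exact (this k i hk hi hik).symm
  · intro h
    funext t
    have := h _ _ _ t.2.1 t.2.2.1
    simp only [signedAngleRigidityMap, key, Pi.zero_apply]
    linarith

/-! ### Trivial motions -/

theorem mem_trivialBearingMotions_iff :
    v ∈ trivialBearingMotions p ↔ ∃ (c : ℝ) (ξ : Plane), ∀ i, v i = c • p i + ξ := by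
  constructor
  · intro h
    refine Submodule.span_induction ?_ ⟨0, 0, by simp⟩ ?_ ?_ h
    · rintro x (rfl | ⟨ξ, rfl⟩)
      · exact ⟨1, 0, by simp⟩
      · exact ⟨0, ξ, by simp⟩
    · rintro x y - - ⟨c, ξ, hx⟩ ⟨d, η, hy⟩
      exact ⟨c + d, ξ + η, fun i => by rw [Pi.add_apply, hx, hy]; module⟩
    · rintro a x - ⟨c, ξ, hx⟩
      exact ⟨a * c, a • ξ, fun i => by rw [Pi.smul_apply, hx]; module⟩
  · rintro ⟨c, ξ, h⟩
    have : v = c • p + fun _ => ξ := funext h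
    rw [this]
    exact add_mem (Submodule.smul_mem _ _ (Submodule.subset_span (Or.inl rfl)))
      (Submodule.subset_span (Or.inr ⟨ξ, rfl⟩))

theorem mem_trivialSignedAngleMotions_iff :
    v ∈ trivialSignedAngleMotions p ↔
      ∃ (c s : ℝ) (ξ : Plane), ∀ i, v i = rot c s (p i) + ξ := by
  constructor
  · intro h
    refine Submodule.span_induction ?_ ⟨0, 0, 0, by simp [rot]⟩ ?_ ?_ h
    · rintro x ((rfl | rfl) | ⟨ξ, rfl⟩)
      · exact ⟨1, 0, 0, by simp [rot]⟩
      · exact ⟨0, 1, 0, by simp [rot]⟩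
      · exact ⟨0, 0, ξ, by simp [rot]⟩
    · rintro x y - - ⟨c, s, ξ, hx⟩ ⟨d, t, η, hy⟩
      exact ⟨c + d, s + t, ξ + η, fun i => by rw [Pi.add_apply, hx, hy]; simp only [rot]; module⟩
    · rintro a x - ⟨c, s, ξ, hx⟩
      exact ⟨a * c, a * s, a • ξ, fun i => by rw [Pi.smul_apply, hx]; simp only [rot]; module⟩
  · rintro ⟨c, s, ξ, h⟩
    have : v = c • p + s • (fun i => perp (p i)) + fun _ => ξ := funext h
    rw [this]
    exact add_mem (add_mem
      (Submodule.smul_mem _ _ (Submodule.subset_span (Or.inl (Or.inl rfl))))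
      (Submodule.smul_mem _ _ (Submodule.subset_span (Or.inl (Or.inr rfl)))))
      (Submodule.subset_span (Or.inr ⟨ξ, rfl⟩))

theorem rot_eq_zero {c s : ℝ} {x : Plane} (hx : x ≠ 0) (h : rot c s x = 0) : c = 0 ∧ s = 0 := by
  have hn : x 0 ^ 2 + x 1 ^ 2 ≠ 0 := by
    rw [← norm_sq_coord]; exact pow_ne_zero 2 (norm_ne_zero_iff.2 hx)
  have h0 := congrArg (fun y : Plane => y 0) h
  have h1 := congrArg (fun y : Plane => y 1) h
  simp at h0 h1
  constructor <;> refine (mul_eq_zero.1 ?_).resolve_right hn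
  · linear_combination (x 0) * h0 + (x 1) * h1
  · linear_combination (x 0) * h1 - (x 1) * h0

theorem rot_sub (c s : ℝ) (x y : Plane) : rot c s (x - y) = rot c s x - rot c s y := by
  refine plane_ext ?_ ?_ <;> simp <;> ring

/-- A trivial motion that agrees at two vertices is constant. -/
theorem eq_of_trivial_of_eq (hp : Function.Injective p) (hv : v ∈ trivialSignedAngleMotions p)
    {a b : Fin n} (hab : a ≠ b) (h : v a = v b) (i j : Fin n) : v i = v j := by
  obtain ⟨c, s, ξ, hv⟩ := mem_trivialSignedAngleMotions_iff.1 hv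
  have : rot c s (p a - p b) = 0 := by
    rw [rot_sub, sub_eq_zero]; rw [hv, hv] at h; exact add_right_cancel h
  obtain ⟨rfl, rfl⟩ := rot_eq_zero (sub_ne_zero.2 (hp.ne hab)) this
  simp [hv, rot]

/-- Among two sides of a partition of at least three vertices, one has two vertices. -/
theorem exists_ne_same_side (hn : 3 ≤ n) (S : Set (Fin n)) :
    ∃ a b : Fin n, a ≠ b ∧ (a ∈ S ↔ b ∈ S) := by
  let x : Fin n := ⟨0, by omega⟩
  let y : Fin n := ⟨1, by omega⟩
  let z : Fin n := ⟨2, by omega⟩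
  have hxy : x ≠ y := by simp [x, y]
  have hxz : x ≠ z := by simp [x, z]
  have hyz : y ≠ z := by simp [y, z]
  by_contra! h
  have := h x y hxy
  have := h x z hxz
  have := h y z hyz
  tauto

/-- If every infinitesimal bearing motion is trivial up to rotation, the graph is connected. -/
theorem connected_of_kernel_le (hn : 3 ≤ n) (hp : Function.Injective p)
    (h : ∀ v, bearingRigidityMap G p v = 0 → v ∈ trivialSignedAngleMotions p) :
    G.Connected := by
  classical
  have : Nonempty (Fin n) := ⟨⟨0, by omega⟩⟩
  refine SimpleGraph.Connected.mk fun i j => ?_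
  by_contra hij
  let S : Set (Fin n) := {k | G.Reachable i k}
  -- Translate the component of `i` and fix everything else.
  let w : Config n := fun k => if k ∈ S then !₂[1, 0] else 0
  have hw : w ∈ trivialSignedAngleMotions p := by
    refine h _ ((bearingRigidityMap_eq_zero_iff hp).2 fun a b hab => ?_)
    have : a ∈ S ↔ b ∈ S :=
      ⟨fun ha => ha.trans hab.reachable, fun hb => hb.trans hab.symm.reachable⟩
    have : w a = w b := by simp only [w, this]
    simp [this, cross]
  -- Here `n ≥ 3` matters: with two vertices, `w` would be a rotation combined with a scaling.
  obtain ⟨a, b, hab, hS⟩ := exists_ne_same_side hn S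
  have := eq_of_trivial_of_eq hp hw hab (by simp only [w, hS]) i j
  have hi : i ∈ S := SimpleGraph.Reachable.refl i
  have hj : j ∉ S := hij
  simp only [w, hi, hj, if_true, if_false] at this
  simpa using congrArg (fun y : Plane => y 0) this

theorem trivialBearing_le : trivialBearingMotions p ≤ trivialSignedAngleMotions p := by
  intro v hv
  obtain ⟨c, ξ, h⟩ := mem_trivialBearingMotions_iff.1 hv
  exact mem_trivialSignedAngleMotions_iff.2 ⟨c, 0, ξ, by simpa [rot] using h⟩

theorem IsIBR.connected (hn : 3 ≤ n) (hp : Function.Injective p) (h : IsIBR G p) :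
    G.Connected :=
  connected_of_kernel_le hn hp fun v hv => trivialBearing_le (h v hv)

theorem exists_adj_of_connected (hn : 3 ≤ n) (h : G.Connected) : ∃ i j, G.Adj i j := by
  have : Nontrivial (Fin n) := Fin.nontrivial_iff_two_le.2 (by omega)
  exact ⟨_, h.preconnected.exists_adj_of_nontrivial ⟨0, by omega⟩⟩

/-- A rotation turns every edge, so its coefficient `s` must vanish as soon as one edge exists. -/
theorem isIBR_of_kernel_le (hn : 3 ≤ n) (hp : Function.Injective p)
    (h : ∀ v, bearingRigidityMap G p v = 0 → v ∈ trivialSignedAngleMotions p) : IsIBR G p := by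
  intro v hv
  obtain ⟨i, j, hij⟩ := exists_adj_of_connected hn (connected_of_kernel_le hn hp h)
  obtain ⟨c, s, ξ, hc⟩ := mem_trivialSignedAngleMotions_iff.1 (h v hv)
  have h0 := (bearingRigidityMap_eq_zero_iff hp).1 hv i j hij
  have hs : s * ‖p i - p j‖ ^ 2 = 0 := by
    rw [hc, hc] at h0
    rw [norm_sq_coord]
    simp only [cross, PiLp.sub_apply, PiLp.add_apply, rot_zero_coord, rot_one_coord] at h0 ⊢
    linear_combination h0
  have hs : s = 0 := (mul_eq_zero.1 hs).resolve_right
    (pow_ne_zero 2 (norm_ne_zero_iff.2 (sub_ne_zero.2 (hp.ne hij.ne))))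
  exact mem_trivialBearingMotions_iff.2 ⟨c, ξ, by simpa [hs, rot] using hc⟩

/-- A function on directed edges that is symmetric and constant around every vertex is
constant if the graph is connected. -/
theorem exists_const_on_edges {α : Type*} (hn : 3 ≤ n) (hG : G.Connected) (f : Fin n → Fin n → α)
    (hs : ∀ i j, G.Adj i j → f i j = f j i)
    (hv : ∀ j i k, G.Adj j i → G.Adj j k → f j i = f j k) :
    ∃ a b, G.Adj a b ∧ ∀ i j, G.Adj i j → f i j = f a b := by
  obtain ⟨a, b, hab⟩ := exists_adj_of_connected hn hG
  refine ⟨a, b, hab, fun i j hij => ?_⟩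
  obtain ⟨w⟩ := hG.preconnected i a
  induction w generalizing j b with
  | nil => exact hv _ _ _ hij hab
  | cons h w ih =>
    rw [hv _ _ _ hij h, hs _ _ h]
    exact ih b hab _ h.symm

end PlanarRigidity

namespace PlanarRigidity

variable {n : ℕ} {G : SimpleGraph (Fin n)} {p q v : Config n}

/-! ### Infinitesimal bearing rigidity implies the other notions -/

/-- If all points were on one line, sliding a single point along it would be a nontrivial bearing
motion. -/
theorem IsIBR.isNondegenerate (hn : 3 ≤ n) (hp : Function.Injective p) (h : IsIBR G p) :
    IsNondegenerate p := by
  classical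
  intro hcol
  let a : Fin n := ⟨0, by omega⟩
  let b : Fin n := ⟨1, by omega⟩
  let d : Fin n := ⟨2, by omega⟩
  have hab : a ≠ b := by simp [a, b]
  have had : a ≠ d := by simp [a, d]
  have hbd : b ≠ d := by simp [b, d]
  obtain ⟨u, hu⟩ := (collinear_iff_of_mem (Set.mem_range_self a)).1 hcol
  have hu : ∀ i, ∃ r : ℝ, p i = r • u + p a := fun i => hu _ (Set.mem_range_self i)
  choose r hr using hu
  have hu0 : u ≠ 0 := by
    rintro rfl
    exact hp.ne hab.symm (by rw [hr b, smul_zero, zero_add])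
  have hpar : ∀ i j, p i - p j = (r i - r j) • u := fun i j => by rw [hr i, hr j]; module
  let w : Config n := Pi.single a u
  have hw : w ∈ trivialBearingMotions p := by
    refine h w ((bearingRigidityMap_eq_zero_iff hp).2 fun i j _ => ?_)
    have : ∃ t : ℝ, w i - w j = t • u := by
      refine ⟨(if i = a then 1 else 0) - (if j = a then 1 else 0), ?_⟩
      simp only [w, Pi.single_apply]
      split_ifs <;> simp
    obtain ⟨t, ht⟩ := this
    rw [hpar, ht]
    simp [cross]; ring
  have := eq_of_trivial_of_eq hp (trivialBearing_le hw) hbd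
    (by simp [w, hab.symm, had.symm]) a b
  simp [w, hab.symm, hu0] at this

/-- Configurations with the same bearings on `G` as `p` are infinitesimal bearing motions. -/
theorem kernel_of_parallel (hp : Function.Injective p)
    (h : ∀ i j, G.Adj i j → ∃ t : ℝ, q i - q j = t • (p i - p j)) :
    bearingRigidityMap G p q = 0 := by
  refine (bearingRigidityMap_eq_zero_iff hp).2 fun i j hij => ?_
  obtain ⟨t, ht⟩ := h i j hij
  rw [ht]
  simp [cross]; ring

/-- Replaces the definition by cases with two polynomial expressions in the bearings. -/
theorem cos_sin_signedAngle {i j k : Fin n} (hi : p i ≠ p j) (hk : p k ≠ p j) :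
    Real.cos (signedAngle p i j k) = inner ℝ (bearing p j k) (bearing p j i) ∧
      Real.sin (signedAngle p i j k) = cross (bearing p j i) (bearing p j k) := by
  have hb := bearing_sq hi
  have hc := bearing_sq hk
  rw [signedAngle, inner_perp]
  generalize bearing p j k = x at *
  generalize bearing p j i = y at *
  have hsum : (inner ℝ x y : ℝ) ^ 2 + cross y x ^ 2 = 1 := by
    rw [inner_coord, cross]
    linear_combination (x 0 ^ 2 + x 1 ^ 2) * hb + hc
  have h1 : -1 ≤ (inner ℝ x y : ℝ) := by nlinarith [sq_nonneg (cross y x)]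
  have h2 : (inner ℝ x y : ℝ) ≤ 1 := by nlinarith [sq_nonneg (cross y x)]
  have h3 : 1 - (inner ℝ x y : ℝ) ^ 2 = cross y x ^ 2 := by linarith
  split_ifs with h
  · rw [Real.cos_arccos h1 h2, Real.sin_arccos, h3, Real.sqrt_sq h]
    exact ⟨rfl, rfl⟩
  · rw [Real.cos_two_pi_sub, Real.sin_two_pi_sub, Real.cos_arccos h1 h2, Real.sin_arccos, h3,
      Real.sqrt_sq_eq_abs, abs_of_neg (not_le.1 h), neg_neg]
    exact ⟨rfl, rfl⟩

theorem signedAngle_eq_of_rot {c s : ℝ} (h : c ^ 2 + s ^ 2 = 1) {i j k : Fin n}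
    (hi : bearing q j i = rot c s (bearing p j i))
    (hk : bearing q j k = rot c s (bearing p j k)) :
    signedAngle q i j k = signedAngle p i j k := by
  have h1 : (inner ℝ (bearing q j k) (perp (bearing q j i)) : ℝ) =
      inner ℝ (bearing p j k) (perp (bearing p j i)) := by
    rw [hi, hk, inner_perp, inner_perp]
    simp only [cross, rot_zero_coord, rot_one_coord]
    linear_combination (bearing p j i 0 * bearing p j k 1 - bearing p j i 1 * bearing p j k 0) * h
  have h2 : (inner ℝ (bearing q j k) (bearing q j i) : ℝ) =
      inner ℝ (bearing p j k) (bearing p j i) := by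
    rw [hi, hk, inner_coord, inner_coord]
    simp only [rot_zero_coord, rot_one_coord]
    linear_combination (bearing p j k 0 * bearing p j i 0 + bearing p j k 1 * bearing p j i 1) * h
  rw [signedAngle, signedAngle, h1, h2]

/-- On a connected graph the signed angles determine the bearings up to a common rotation. -/
theorem exists_rot_of_signedAngleFun_eq (hn : 3 ≤ n) (hG : G.Connected)
    (hp : Function.Injective p) (hq : ∀ i j, G.Adj i j → q i ≠ q j)
    (h : signedAngleFun G q = signedAngleFun G p) :
    ∃ c s : ℝ, c ^ 2 + s ^ 2 = 1 ∧
      ∀ j i, G.Adj j i → bearing q j i = rot c s (bearing p j i) := by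
  -- Cosine and sine of the rotation taking the bearing in `p` to the bearing in `q`.
  let f : Fin n → Fin n → ℝ × ℝ := fun j i =>
    (inner ℝ (bearing p j i) (bearing q j i), cross (bearing p j i) (bearing q j i))
  have hlt : ∀ j i k, G.Adj j i → G.Adj j k → i < k → f j i = f j k := by
    intro j i k hi hk hik
    have ha : signedAngle q i j k = signedAngle p i j k := congrFun h ⟨(i, j, k), hi, hk, hik⟩
    obtain ⟨c1, s1⟩ := cos_sin_signedAngle (hp.ne hi.ne') (hp.ne hk.ne')
    obtain ⟨c2, s2⟩ := cos_sin_signedAngle (hq _ _ hi.symm) (hq _ _ hk.symm)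
    rw [ha] at c2 s2
    have hc := c1.symm.trans c2
    have hs := s1.symm.trans s2
    have e1 := bearing_sq (hp.ne hk.ne')
    have e2 := bearing_sq (hq _ _ hi.symm)
    simp only [f]
    generalize bearing p j k = x at *
    generalize bearing p j i = y at *
    generalize bearing q j k = z at *
    generalize bearing q j i = w at *
    rw [inner_coord, inner_coord] at hc
    rw [cross, cross] at hs
    rw [Prod.mk.injEq, inner_coord, inner_coord, cross, cross]
    -- In complex notation: `x * conj y = z * conj w` is multiplied by `conj x * w`, where `x` and
    -- `w` are unit vectors, to give `conj y * w = conj x * z`.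
    constructor
    · linear_combination -(y 0 * w 0 + y 1 * w 1) * e1 + (w 0 * x 0 + w 1 * x 1) * hc
        - (w 1 * x 0 - w 0 * x 1) * hs + (x 0 * z 0 + x 1 * z 1) * e2
    · linear_combination -(y 0 * w 1 - y 1 * w 0) * e1 + (w 1 * x 0 - w 0 * x 1) * hc
        + (w 0 * x 0 + w 1 * x 1) * hs + (x 0 * z 1 - x 1 * z 0) * e2
  obtain ⟨a, b, hab, hf⟩ := exists_const_on_edges hn hG f
    (by
      intro i j _
      simp only [f]
      rw [bearing_swap p j i, bearing_swap q j i]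
      simp [cross])
    (by
      intro j i k hi hk
      rcases lt_trichotomy i k with hik | rfl | hik
      · exact hlt j i k hi hk hik
      · rfl
      · exact (hlt j k i hk hi hik).symm)
  refine ⟨(f a b).1, (f a b).2, ?_, ?_⟩
  · have e1 := bearing_sq (hp.ne hab.ne')
    have e2 := bearing_sq (hq _ _ hab.symm)
    simp only [f, inner_coord, cross]
    linear_combination (bearing q a b 0 ^ 2 + bearing q a b 1 ^ 2) * e1 + e2
  · intro j i hji
    rw [← hf j i hji]
    have e1 := bearing_sq (hp.ne hji.ne')
    simp only [f]
    rw [inner_coord, cross]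
    refine plane_ext ?_ ?_
    · rw [rot_zero_coord]
      linear_combination -(bearing q j i 0) * e1
    · rw [rot_one_coord]
      linear_combination -(bearing q j i 1) * e1

theorem rot_smul (c s t : ℝ) (x : Plane) : rot c s (t • x) = t • rot c s x := by
  refine plane_ext ?_ ?_ <;> simp <;> ring

theorem rot_rot_inv {c s : ℝ} (h : c ^ 2 + s ^ 2 = 1) (x : Plane) :
    rot c (-s) (rot c s x) = x := by
  refine plane_ext ?_ ?_ <;> simp
  · linear_combination (x 0) * h
  · linear_combination (x 1) * h

theorem rot_inv_rot {c s : ℝ} (h : c ^ 2 + s ^ 2 = 1) (x : Plane) :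
    rot c s (rot c (-s) x) = x := by
  refine plane_ext ?_ ?_ <;> simp
  · linear_combination (x 0) * h
  · linear_combination (x 1) * h

/-- On an infinitesimally bearing rigid framework, a configuration whose bearings on `G` are
the rotated bearings of `p` is similar to `p`. -/
theorem IsIBR.eq_smul_rot (hn : 3 ≤ n) (hp : Function.Injective p) (hI : IsIBR G p)
    {c s : ℝ} (h : c ^ 2 + s ^ 2 = 1) (hq : ∀ i j, G.Adj i j → q i ≠ q j)
    (hb : ∀ j i, G.Adj j i → bearing q j i = rot c s (bearing p j i)) :
    ∃ t : ℝ, 0 < t ∧ ∀ i j, q i - q j = t • rot c s (p i - p j) := by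
  have hq' : ∀ i j, G.Adj i j →
      q i - q j = (‖q i - q j‖ * ‖p i - p j‖⁻¹) • rot c s (p i - p j) := by
    intro i j hij
    conv_lhs => rw [← norm_smul_bearing (hq i j hij), hb j i hij.symm]
    rw [bearing, rot_smul, smul_smul]
  -- The configuration `q`, rotated back, is read as a velocity at `p`.
  have hker : bearingRigidityMap G p (fun i => rot c (-s) (q i)) = 0 := by
    refine kernel_of_parallel hp fun i j hij => ⟨‖q i - q j‖ * ‖p i - p j‖⁻¹, ?_⟩
    rw [← rot_sub]
    conv_lhs => rw [hq' i j hij, rot_smul, rot_rot_inv h]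
  obtain ⟨t, ξ, ht⟩ := mem_trivialBearingMotions_iff.1 (hI _ hker)
  have hdiff : ∀ i j, q i - q j = t • rot c s (p i - p j) := by
    intro i j
    have : rot c (-s) (q i - q j) = t • (p i - p j) := by
      rw [rot_sub]
      have hi := ht i
      have hj := ht j
      rw [hi, hj]
      module
    rw [← rot_inv_rot h (q i - q j), this, rot_smul]
  refine ⟨t, ?_, hdiff⟩
  obtain ⟨a, b, hab⟩ := exists_adj_of_connected hn (hI.connected hn hp)
  have hpab : 0 < ‖p a - p b‖ := norm_pos_iff.2 (sub_ne_zero.2 (hp.ne hab.ne))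
  have hqab : 0 < ‖q a - q b‖ := norm_pos_iff.2 (sub_ne_zero.2 (hq a b hab))
  have hne : rot c s (p a - p b) ≠ 0 := by
    rw [← norm_ne_zero_iff, norm_rot h]; exact hpab.ne'
  have := (hdiff a b).symm.trans (hq' a b hab)
  -- On an edge, `t` is a quotient of two lengths, hence positive.
  rw [smul_left_injective ℝ hne this]
  positivity

theorem ne_of_smul_rot (hp : Function.Injective p) {c s t : ℝ} (h : c ^ 2 + s ^ 2 = 1)
    (ht : 0 < t) (hd : ∀ i j, q i - q j = t • rot c s (p i - p j)) {i j : Fin n}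
    (hij : i ≠ j) : q i ≠ q j := by
  intro he
  have := hd i j
  rw [he, sub_self] at this
  have := congrArg norm this
  rw [norm_zero, norm_smul, norm_rot h, Real.norm_of_nonneg ht.le] at this
  have : 0 < ‖p i - p j‖ := norm_pos_iff.2 (sub_ne_zero.2 (hp.ne hij))
  have := mul_pos ht this
  linarith

theorem fibre_top_subset_bearing : fibre bearingFun ⊤ p ⊆ fibre bearingFun G p := by
  rintro q ⟨hq, h⟩
  exact ⟨fun i j hij => hq i j hij.ne, funext fun e => congrFun h ⟨e.1, e.2.ne⟩⟩

theorem fibre_top_subset_signedAngle :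
    fibre signedAngleFun ⊤ p ⊆ fibre signedAngleFun G p := by
  rintro q ⟨hq, h⟩
  exact ⟨fun i j hij => hq i j hij.ne,
    funext fun t => congrFun h ⟨t.1, t.2.1.ne, t.2.2.1.ne, t.2.2.2⟩⟩

theorem IsIBR.isGBR (hn : 3 ≤ n) (hp : Function.Injective p) (hI : IsIBR G p) : IsGBR G p := by
  refine (fibre_top_subset_bearing.antisymm ?_).symm
  rintro q ⟨hq, h⟩
  have h1 : (1 : ℝ) ^ 2 + 0 ^ 2 = 1 := by norm_num
  obtain ⟨t, ht, hd⟩ := hI.eq_smul_rot hn hp h1 hq (fun j i hij => by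
    rw [rot_one_zero]; exact congrFun h ⟨(j, i), hij⟩)
  refine ⟨fun i j hij => ne_of_smul_rot hp h1 ht hd hij, funext fun e => ?_⟩
  have := bearing_eq_rot h1 ht (hd e.1.2 e.1.1)
  rwa [rot_one_zero] at this

theorem IsIBR.isGSAR (hn : 3 ≤ n) (hp : Function.Injective p) (hI : IsIBR G p) :
    IsGSAR G p := by
  refine (fibre_top_subset_signedAngle.antisymm ?_).symm
  rintro q ⟨hq, h⟩
  obtain ⟨c, s, h1, hb⟩ := exists_rot_of_signedAngleFun_eq hn (hI.connected hn hp) hp hq h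
  obtain ⟨t, ht, hd⟩ := hI.eq_smul_rot hn hp h1 hq hb
  exact ⟨fun i j hij => ne_of_smul_rot hp h1 ht hd hij, funext fun e =>
    signedAngle_eq_of_rot h1 (bearing_eq_rot h1 ht (hd _ _)) (bearing_eq_rot h1 ht (hd _ _))⟩

theorem IsGBR.isBR (h : IsGBR G p) : IsBR G p :=
  ⟨Set.univ, Filter.univ_mem, fun q hq => by
    have : q ∈ fibre bearingFun ⊤ p := h ▸ hq.1
    exact this.2⟩

theorem IsGSAR.isSAR (h : IsGSAR G p) : IsSAR G p :=
  ⟨Set.univ, Filter.univ_mem, fun q hq => by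
    have : q ∈ fibre signedAngleFun ⊤ p := h ▸ hq.1
    exact this.2⟩

/-- Connectedness makes the angular velocities of all edges one number `ω`; subtracting the rotation
with speed `ω` leaves a bearing motion. -/
theorem IsIBR.isISAR (hn : 3 ≤ n) (hp : Function.Injective p) (hI : IsIBR G p) :
    IsISAR G p := by
  intro v hv
  rw [signedAngleRigidityMap_eq_zero_iff] at hv
  obtain ⟨a, b, -, hω⟩ := exists_const_on_edges hn (hI.connected hn hp)
    (fun j i => cross (p i - p j) (v i - v j) / ‖p i - p j‖ ^ 2)
    (fun i j _ => by
      rw [norm_sub_rev (p j) (p i)]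
      congr 1
      simp [cross]; ring) hv
  set ω : ℝ := cross (p b - p a) (v b - v a) / ‖p b - p a‖ ^ 2
  have hw : bearingRigidityMap G p (fun i => v i - ω • perp (p i)) = 0 := by
    refine (bearingRigidityMap_eq_zero_iff hp).2 fun i j hij => ?_
    have := hω j i hij.symm
    rw [div_eq_iff (pow_ne_zero 2 (norm_ne_zero_iff.2 (sub_ne_zero.2 (hp.ne hij.ne)))),
      norm_sq_coord] at this
    simp only [cross, PiLp.sub_apply, PiLp.smul_apply, perp_zero_coord, perp_one_coord,
      smul_eq_mul] at this ⊢
    linear_combination this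
  obtain ⟨c, ξ, h⟩ := mem_trivialBearingMotions_iff.1 (hI _ hw)
  refine mem_trivialSignedAngleMotions_iff.2 ⟨c, ω, ξ, fun i => ?_⟩
  have := h i
  rw [sub_eq_iff_eq_add.1 this, rot]
  abel

/-! ### The other notions imply infinitesimal bearing rigidity -/

/-- Under a bearing motion every edge has angular velocity zero. -/
theorem IsISAR.isIBR (hn : 3 ≤ n) (hp : Function.Injective p) (h : IsISAR G p) : IsIBR G p := by
  refine isIBR_of_kernel_le hn hp fun v hv => h v ?_
  rw [bearingRigidityMap_eq_zero_iff hp] at hv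
  rw [signedAngleRigidityMap_eq_zero_iff]
  intro j i k hi hk
  rw [hv _ _ hi.symm, hv _ _ hk.symm, zero_div, zero_div]

/-- A velocity parallel to all difference vectors of a non-degenerate configuration is a
combination of a scaling and a translation. -/
theorem exists_smul_add_of_parallel (hn : 3 ≤ n) (hp : Function.Injective p)
    (hnd : IsNondegenerate p) (h : ∀ i j, cross (p i - p j) (v i - v j) = 0) :
    ∃ (c : ℝ) (ξ : Plane), ∀ i, v i = c • p i + ξ := by
  let a : Fin n := ⟨0, by omega⟩
  let b : Fin n := ⟨1, by omega⟩
  have hab : b ≠ a := by simp [a, b]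
  have hpab : p b - p a ≠ 0 := sub_ne_zero.2 (hp.ne hab)
  obtain ⟨c, hc⟩ := exists_smul_of_cross_eq_zero hpab (h b a)
  obtain ⟨d, hd⟩ : ∃ d, cross (p b - p a) (p d - p a) ≠ 0 := by
    by_contra! hall
    refine hnd ((collinear_iff_of_mem (Set.mem_range_self a)).2 ⟨p b - p a, ?_⟩)
    rintro _ ⟨i, rfl⟩
    obtain ⟨r, hr⟩ := exists_smul_of_cross_eq_zero hpab (hall i)
    exact ⟨r, by rw [vadd_eq_add, ← hr, sub_add_cancel]⟩
  -- After a translation and a scaling are subtracted, the motion vanishes at `a` and `b`. It then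
  -- vanishes at any point seen from two fixed points in independent directions: at `d`, which is
  -- off the line `ab`, and then everywhere else.
  let w : Config n := fun i => v i - v a - c • (p i - p a)
  have hw : ∀ i j, cross (p i - p j) (w i - w j) = 0 := by
    intro i j
    have := h i j
    simp only [w, cross, PiLp.sub_apply, PiLp.smul_apply, smul_eq_mul] at this ⊢
    linear_combination this
  have hwa : w a = 0 := by simp [w]
  have hwb : w b = 0 := by simp [w, hc]
  have key : ∀ i k l, w k = 0 → w l = 0 → cross (p i - p k) (p i - p l) ≠ 0 → w i = 0 := by
    intro i k l hk hl hkl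
    have h1 := hw i k
    have h2 := hw i l
    rw [hk, sub_zero] at h1
    rw [hl, sub_zero] at h2
    exact eq_zero_of_cross_eq_zero hkl h1 h2
  have hflip : ∀ i k l, cross (p k - p l) (p i - p l) ≠ 0 → cross (p i - p k) (p i - p l) ≠ 0 := by
    intro i k l hne he
    apply hne
    simp only [cross, PiLp.sub_apply] at he ⊢
    linear_combination -he
  have hwd : w d = 0 := key d b a hwb hwa (hflip _ _ _ hd)
  have hwi : ∀ i, w i = 0 := by
    intro i
    by_cases h1 : cross (p b - p a) (p i - p a) = 0
    · by_cases h2 : cross (p d - p a) (p i - p a) = 0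
      -- A point on both lines `ab` and `ad` is `p a`.
      · have : p i = p a := sub_eq_zero.1 (eq_zero_of_cross_eq_zero hd h1 h2)
        rw [hp this, hwa]
      · exact key i d a hwd hwa (hflip _ _ _ h2)
    · exact key i b a hwb hwa (hflip _ _ _ h1)
  refine ⟨c, v a - c • p a, fun i => ?_⟩
  have : v i = v a + c • (p i - p a) := by
    have := hwi i
    simp only [w] at this
    rw [sub_sub, sub_eq_zero] at this
    exact this
  rw [this]
  module

/-- Small infinitesimal bearing motions preserve the bearings of `G`. -/
theorem exists_small_motion (hp : Function.Injective p) (hv : bearingRigidityMap G p v = 0)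
    {U : Set (Config n)} (hU : U ∈ 𝓝 p) :
    ∃ ε : ℝ, ε ≠ 0 ∧ p + ε • v ∈ U ∧ Function.Injective (p + ε • v) ∧
      ∀ j i, G.Adj j i → bearing (p + ε • v) j i = bearing p j i := by
  have hlam : ∀ i j, ∃ l : ℝ, G.Adj i j → v i - v j = l • (p i - p j) := by
    intro i j
    by_cases hij : G.Adj i j
    · obtain ⟨l, hl⟩ := exists_smul_of_cross_eq_zero (sub_ne_zero.2 (hp.ne hij.ne))
        ((bearingRigidityMap_eq_zero_iff hp).1 hv i j hij)
      exact ⟨l, fun _ => hl⟩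
    · exact ⟨0, fun h => absurd h hij⟩
  choose l hl using hlam
  have hcont : ContinuousAt (fun ε : ℝ => p + ε • v) 0 := by fun_prop
  have e1 : ∀ᶠ ε : ℝ in 𝓝 0, p + ε • v ∈ U := hcont (by simpa using hU)
  have e2 : ∀ᶠ ε : ℝ in 𝓝 0, ∀ i j, 0 < 1 + ε * l i j := by
    rw [Filter.eventually_all]; intro i
    rw [Filter.eventually_all]; intro j
    have : ContinuousAt (fun ε : ℝ => 1 + ε * l i j) 0 := by fun_prop
    exact this.eventually (lt_mem_nhds (by simp))
  have e3 : ∀ᶠ ε : ℝ in 𝓝 0, ∀ i j, i ≠ j → (p + ε • v) i - (p + ε • v) j ≠ 0 := by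
    rw [Filter.eventually_all]; intro i
    rw [Filter.eventually_all]; intro j
    by_cases hij : i = j
    · simp [hij]
    · have : ContinuousAt (fun ε : ℝ => (p + ε • v) i - (p + ε • v) j) 0 := by
        simp only [Pi.add_apply, Pi.smul_apply]; fun_prop
      have := this.eventually_ne (y := 0) (by simpa using sub_ne_zero.2 (hp.ne hij))
      filter_upwards [this] with ε hε _ using hε
  -- Zero is excluded because `ε` is later divided out.
  have e4 : ∀ᶠ ε : ℝ in 𝓝[≠] 0, ε ≠ 0 := self_mem_nhdsWithin
  have := ((e1.and (e2.and e3)).filter_mono (nhdsWithin_le_nhds (s := {0}ᶜ))).and e4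
  obtain ⟨ε, ⟨h1, h2, h3⟩, h4⟩ := this.exists
  refine ⟨ε, h4, h1, fun i j hij => ?_, fun j i hji => ?_⟩
  · by_contra hne
    exact h3 i j hne (sub_eq_zero.2 hij)
  -- Along an edge the difference is multiplied by `1 + ε * l i j`, which is positive.
  · refine bearing_eq_of_pos_smul (h2 i j) ?_
    simp only [Pi.add_apply, Pi.smul_apply]
    rw [add_sub_add_comm, ← smul_sub, hl i j hji.symm]
    module

/-- Rigidity makes `p + ε • v` agree with `p` in all bearings, not only those of `G`; so `v` is
parallel to all differences of `p`, and non-degeneracy makes it trivial. -/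
theorem IsBR.isIBR (hn : 3 ≤ n) (hp : Function.Injective p) (hnd : IsNondegenerate p)
    (h : IsBR G p) : IsIBR G p := by
  obtain ⟨U, hU, h⟩ := h
  intro v hv
  obtain ⟨ε, hε, hmem, hinj, hb⟩ := exists_small_motion hp hv hU
  have hK := h _ ⟨⟨fun i j hij => hinj.ne hij.ne, funext fun e => hb _ _ e.2⟩, hmem⟩
  refine mem_trivialBearingMotions_iff.2 (exists_smul_add_of_parallel hn hp hnd fun i j => ?_)
  by_cases hij : i = j
  · simp [hij, cross]
  · have hbij : bearing (p + ε • v) j i = bearing p j i :=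
      congrFun hK ⟨(j, i), Ne.symm hij⟩
    have e := norm_smul_bearing (hinj.ne hij)
    rw [hbij, bearing, smul_smul] at e
    generalize ‖(p + ε • v) i - (p + ε • v) j‖ * ‖p i - p j‖⁻¹ = t at e
    have e0 := congrArg (fun y : Plane => y 0) e
    have e1 := congrArg (fun y : Plane => y 1) e
    simp at e0 e1
    refine (mul_eq_zero.1 ?_).resolve_left hε
    simp only [cross, PiLp.sub_apply]
    linear_combination (p i 1 - p j 1) * e0 - (p i 0 - p j 0) * e1

theorem IsSAR.isIBR (hn : 3 ≤ n) (hp : Function.Injective p) (hnd : IsNondegenerate p)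
    (h : IsSAR G p) : IsIBR G p := by
  obtain ⟨U, hU, h⟩ := h
  refine isIBR_of_kernel_le hn hp fun v hv => ?_
  obtain ⟨ε, hε, hmem, hinj, hb⟩ := exists_small_motion hp hv hU
  have h1 : (1 : ℝ) ^ 2 + 0 ^ 2 = 1 := by norm_num
  have hK := h _ ⟨⟨fun i j hij => hinj.ne hij.ne, funext fun e =>
    signedAngle_eq_of_rot h1 (by rw [rot_one_zero, hb _ _ e.2.1])
      (by rw [rot_one_zero, hb _ _ e.2.2.1])⟩, hmem⟩
  have : Nonempty (Fin n) := ⟨⟨0, by omega⟩⟩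
  -- On the complete graph, equal signed angles mean that all bearings differ by one rotation.
  obtain ⟨c, s, hcs, hr⟩ := exists_rot_of_signedAngleFun_eq hn SimpleGraph.connected_top hp
    (fun i j hij => hinj.ne hij.ne) hK
  set q : Config n := p + ε • v with hq
  obtain ⟨t, ξ, ht⟩ := exists_smul_add_of_parallel (v := fun i => rot c (-s) (q i)) hn hp hnd
    fun i j => by
      by_cases hij : i = j
      · simp [hij, cross]
      · rw [← rot_sub, ← norm_smul_bearing (hinj.ne hij), hr j i (Ne.symm hij), rot_smul,
          rot_rot_inv hcs, bearing, smul_smul]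
        simp [cross]; ring
  -- The coefficients come from solving `p + ε • v = rot c s (t • p + ξ)` for `v`.
  refine mem_trivialSignedAngleMotions_iff.2
    ⟨ε⁻¹ * (t * c - 1), ε⁻¹ * (t * s), ε⁻¹ • rot c s ξ, fun i => ?_⟩
  have hqi : q i = rot c s (t • p i + ξ) := by
    rw [← ht i, rot_inv_rot hcs]
  have hvi : v i = ε⁻¹ • (q i - p i) := by
    rw [hq, Pi.add_apply, add_sub_cancel_left, Pi.smul_apply, smul_smul, inv_mul_cancel₀ hε,
      one_smul]
  rw [hvi, hqi]
  refine plane_ext ?_ ?_ <;> simp <;> ring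

/-! ### The six notions coincide -/

theorem isIBR_tfae (hn : 3 ≤ n) (hp : Function.Injective p) :
    List.TFAE [IsIBR G p, OnNondegenerate IsSAR G p, IsISAR G p, OnNondegenerate IsGSAR G p,
      OnNondegenerate IsGBR G p, OnNondegenerate IsBR G p] := by
  tfae_have 1 → 3 := IsIBR.isISAR hn hp
  tfae_have 3 → 1 := IsISAR.isIBR hn hp
  tfae_have 1 → 4 := fun h => ⟨h.isNondegenerate hn hp, h.isGSAR hn hp⟩
  tfae_have 4 → 2 := fun h => ⟨h.1, h.2.isSAR⟩
  tfae_have 2 → 1 := fun h => IsSAR.isIBR hn hp h.1 h.2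
  tfae_have 1 → 5 := fun h => ⟨h.isNondegenerate hn hp, h.isGBR hn hp⟩
  tfae_have 5 → 6 := fun h => ⟨h.1, h.2.isBR⟩
  tfae_have 6 → 1 := fun h => IsBR.isIBR hn hp h.1 h.2
  tfae_finish

end PlanarRigidity

namespace PlanarRigidity

variable {n : ℕ} {G : SimpleGraph (Fin n)} {p q v : Config n}

/-! ### Rows of the rigidity matrix -/

/-- The row of the (rescaled) bearing rigidity matrix belonging to an unordered pair. -/
noncomputable def row (p : Config n) (e : Sym2 (Fin n)) : Module.Dual ℝ (Config n) :=
  Sym2.lift ⟨fun i j =>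
    { toFun := fun v => cross (p i - p j) (v i - v j)
      map_add' := fun v w => by simp [cross]; ring
      map_smul' := fun c v => by simp [cross]; ring },
    fun i j => by
      ext v
      simp [cross]
      ring⟩ e

@[simp] theorem row_mk (p v : Config n) (i j : Fin n) :
    row p s(i, j) v = cross (p i - p j) (v i - v j) := rfl

theorem row_eq_zero_of_agree {X : Finset (Fin n)} {c : ℝ} {ξ : Plane}
    (hv : ∀ i ∈ X, v i = c • p i + ξ) {e : Sym2 (Fin n)} (he : e ∈ X.sym2) : row p e v = 0 := by
  induction e with
  | h i j =>
    rw [Finset.mk_mem_sym2_iff] at he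
    rw [row_mk, hv i he.1, hv j he.2]
    simp [cross]; ring

open Module in
theorem finrank_config : finrank ℝ (Config n) = 2 * n := by
  rw [Module.finrank_pi_fintype]; simp [mul_comm]

open Module in
theorem finrank_span_row {E : Finset (Sym2 (Fin n))} (hE : LinearIndepOn ℝ (row p) (E : Set _)) :
    finrank ℝ (Submodule.span ℝ (row p '' E)) = E.card := by
  have := finrank_span_eq_card (R := ℝ) hE
  rw [Set.image_eq_range, this]
  simp

theorem mem_coannihilator_iff {E : Set (Sym2 (Fin n))} :
    v ∈ (Submodule.span ℝ (row p '' E)).dualCoannihilator ↔ ∀ e ∈ E, row p e v = 0 := by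
  rw [Submodule.mem_dualCoannihilator]
  constructor
  · exact fun h e he => h _ (Submodule.subset_span ⟨e, he, rfl⟩)
  · intro h φ hφ
    refine Submodule.span_induction ?_ (by simp) ?_ ?_ hφ
    · rintro _ ⟨e, he, rfl⟩; exact h e he
    · intro x y _ _ hx hy; simp [hx, hy]
    · intro a x _ hx; simp [hx]

/-- Motions that restrict to a scaling and translation on `X`, parametrized. -/
noncomputable def partialTrivialMotion (p : Config n) (X : Finset (Fin n)) :
    ((ℝ × Plane) × ({i // i ∉ X} → Plane)) →ₗ[ℝ] Config n where
  toFun z i := if h : i ∈ X then z.1.1 • p i + z.1.2 else z.2 ⟨i, h⟩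
  map_add' z w := by
    funext i
    simp only [Pi.add_apply]
    split_ifs
    · simp only [Prod.fst_add, Prod.snd_add]; module
    · rfl
  map_smul' c z := by
    funext i
    simp only [Pi.smul_apply, RingHom.id_apply]
    split_ifs
    · simp only [Prod.smul_fst, Prod.smul_snd, smul_eq_mul]; module
    · rfl

theorem partialTrivialMotion_apply_mem {X : Finset (Fin n)} (z) {i : Fin n} (h : i ∈ X) :
    partialTrivialMotion p X z i = z.1.1 • p i + z.1.2 := dif_pos h

theorem partialTrivialMotion_apply_notMem {X : Finset (Fin n)} (z) {i : Fin n} (h : i ∉ X) :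
    partialTrivialMotion p X z i = z.2 ⟨i, h⟩ := dif_neg h

theorem partialTrivialMotion_injective (hp : Function.Injective p) {X : Finset (Fin n)}
    (hX : 2 ≤ X.card) : Function.Injective (partialTrivialMotion p X) := by
  rw [← LinearMap.ker_eq_bot, LinearMap.ker_eq_bot']
  rintro ⟨⟨c, ξ⟩, w⟩ h
  obtain ⟨a, ha, b, hb, hab⟩ := Finset.one_lt_card.1 hX
  have h1 := congrFun h a
  have h2 := congrFun h b
  rw [partialTrivialMotion_apply_mem _ ha] at h1
  rw [partialTrivialMotion_apply_mem _ hb] at h2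
  simp only [Pi.zero_apply] at h1 h2
  have hc : c • (p a - p b) = 0 := by
    rw [smul_sub, sub_eq_zero]; exact add_right_cancel (h1.trans h2.symm)
  have hc : c = 0 := (smul_eq_zero.1 hc).resolve_right (sub_ne_zero.2 (hp.ne hab))
  have hξ : ξ = 0 := by simpa [hc] using h1
  have hw : w = 0 := by
    funext i
    have := congrFun h i.1
    rwa [partialTrivialMotion_apply_notMem _ i.2] at this
  rw [hc, hξ, hw]; rfl

open Module in
theorem finrank_range_partialTrivialMotion (hp : Function.Injective p) {X : Finset (Fin n)}
    (hX : 2 ≤ X.card) :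
    finrank ℝ (LinearMap.range (partialTrivialMotion p X)) + 2 * X.card = 3 + 2 * n := by
  rw [LinearMap.finrank_range_of_inj (partialTrivialMotion_injective hp hX), finrank_prod,
    finrank_prod, Module.finrank_pi_fintype]
  have hc : Fintype.card {i // i ∉ X} = n - X.card := by
    rw [Fintype.card_subtype_compl]; simp
  have : X.card ≤ n := by simpa using Finset.card_le_univ X
  simp [hc]
  omega

theorem range_partialTrivialMotion_le {X : Finset (Fin n)} {E : Finset (Sym2 (Fin n))}
    (hEX : E ⊆ X.sym2) : LinearMap.range (partialTrivialMotion p X) ≤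
      (Submodule.span ℝ (row p '' E)).dualCoannihilator := by
  rintro _ ⟨z, rfl⟩
  refine mem_coannihilator_iff.2 fun e he => row_eq_zero_of_agree (c := z.1.1) (ξ := z.1.2) ?_
    (hEX he)
  exact fun i hi => partialTrivialMotion_apply_mem z hi

/-- Independent rows supported on `X` number at most `2 |X| - 3`. -/
theorem card_add_three_le (hp : Function.Injective p) {X : Finset (Fin n)} (hX : 2 ≤ X.card)
    {E : Finset (Sym2 (Fin n))} (hEX : E ⊆ X.sym2)
    (hE : LinearIndepOn ℝ (row p) (E : Set _)) : E.card + 3 ≤ 2 * X.card := by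
  -- The common kernel of the rows has dimension `2 * n - E.card` and contains the motions trivial
  -- on `X`, of dimension `3 + 2 * (n - X.card)`.
  have h1 := Subspace.finrank_add_finrank_dualCoannihilator_eq (Submodule.span ℝ (row p '' E))
  have h2 := Submodule.finrank_mono (range_partialTrivialMotion_le (p := p) hEX)
  have h3 := finrank_range_partialTrivialMotion hp hX
  rw [finrank_span_row hE, finrank_config] at h1
  omega

/-- Puts rigidity as an inclusion of subspaces, ready for counting dimensions. -/
theorem isIBR_iff_row (hp : Function.Injective p) : IsIBR G p ↔
    (Submodule.span ℝ (row p '' G.edgeSet)).dualCoannihilator ≤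
      LinearMap.range (partialTrivialMotion p Finset.univ) := by
  have h1 : ∀ v, bearingRigidityMap G p v = 0 ↔
      v ∈ (Submodule.span ℝ (row p '' G.edgeSet)).dualCoannihilator := by
    intro v
    rw [bearingRigidityMap_eq_zero_iff hp, mem_coannihilator_iff]
    constructor
    · intro h e he
      induction e with
      | h i j => exact h i j he
    · exact fun h i j hij => h s(i, j) hij
  have h2 : ∀ v, v ∈ trivialBearingMotions p ↔
      v ∈ LinearMap.range (partialTrivialMotion p Finset.univ) := by
    intro v
    rw [mem_trivialBearingMotions_iff]
    constructor
    · rintro ⟨c, ξ, h⟩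
      exact ⟨((c, ξ), 0), funext fun i => by
        rw [partialTrivialMotion_apply_mem _ (Finset.mem_univ i), h i]⟩
    · rintro ⟨z, rfl⟩
      exact ⟨z.1.1, z.1.2, fun i => partialTrivialMotion_apply_mem _ (Finset.mem_univ i)⟩
  simp only [IsIBR, h1, h2]
  rfl

/-- Independent rows of full number give infinitesimal rigidity. -/
theorem isIBR_of_linearIndepOn (hn : 3 ≤ n) (hp : Function.Injective p)
    {E : Finset (Sym2 (Fin n))} (hG : G.edgeSet = E)
    (hE : LinearIndepOn ℝ (row p) (E : Set _)) (hc : E.card + 3 = 2 * n) : IsIBR G p := by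
  have hX : 2 ≤ (Finset.univ : Finset (Fin n)).card := by simp; omega
  rw [isIBR_iff_row hp, hG]
  refine (Submodule.eq_of_le_of_finrank_le
    (range_partialTrivialMotion_le (by simp)) ?_).ge
  have h1 := Subspace.finrank_add_finrank_dualCoannihilator_eq (Submodule.span ℝ (row p '' E))
  have h3 := finrank_range_partialTrivialMotion hp hX
  rw [finrank_span_row hE, finrank_config] at h1
  rw [Finset.card_fin] at h3
  omega

/-- An infinitesimally bearing rigid framework has `2n - 3` edges with independent rows, which
are rigid by themselves. -/
theorem IsIBR.exists_basis (hn : 3 ≤ n) (hp : Function.Injective p) (h : IsIBR G p) :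
    ∃ E : Finset (Sym2 (Fin n)), (E : Set _) ⊆ G.edgeSet ∧
      LinearIndepOn ℝ (row p) (E : Set _) ∧ E.card + 3 = 2 * n ∧
      IsIBR (SimpleGraph.fromEdgeSet (E : Set (Sym2 (Fin n)))) p := by
  classical
  obtain ⟨b, hb, -, hspan, hli⟩ := exists_linearIndepOn_extension
    (linearIndepOn_empty ℝ (row p)) (Set.empty_subset G.edgeSet)
  obtain ⟨E, rfl⟩ := b.toFinite.exists_finset_coe
  have hX : 2 ≤ (Finset.univ : Finset (Fin n)).card := by simp; omega
  have hspan : Submodule.span ℝ (row p '' G.edgeSet) = Submodule.span ℝ (row p '' E) :=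
    le_antisymm (Submodule.span_le.2 hspan) (Submodule.span_mono (Set.image_mono hb))
  rw [isIBR_iff_row hp, hspan] at h
  have hEd : (SimpleGraph.fromEdgeSet (E : Set (Sym2 (Fin n)))).edgeSet = E := by
    rw [SimpleGraph.edgeSet_fromEdgeSet, sdiff_eq_left, Set.disjoint_left]
    exact fun e he => G.not_isDiag_of_mem_edgeSet (hb he)
  refine ⟨E, hb, hli, ?_, ?_⟩
  · have h1 := Subspace.finrank_add_finrank_dualCoannihilator_eq (Submodule.span ℝ (row p '' E))
    have h2 := Submodule.finrank_mono h
    have h3 := finrank_range_partialTrivialMotion hp hX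
    have h4 := card_add_three_le hp hX (by simp) hli
    rw [finrank_span_row hli, finrank_config] at h1
    rw [Finset.card_fin] at h3 h4
    omega
  · rwa [isIBR_iff_row hp, hEd]

end PlanarRigidity

namespace PlanarRigidity

/-! ### Sparse edge sets -/

section Sparse

variable {V : Type*} [DecidableEq V]

/-- The `(2, 3)`-sparsity condition for a set of edges. -/
def Sparse (E : Finset (Sym2 V)) : Prop :=
  (∀ e ∈ E, ¬ e.IsDiag) ∧ ∀ X : Finset V, 2 ≤ X.card → (E ∩ X.sym2).card + 3 ≤ 2 * X.card

variable {E F : Finset (Sym2 V)} {X Y Z : Finset V}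

theorem Sparse.mono (h : Sparse E) (hF : F ⊆ E) : Sparse F :=
  ⟨fun e he => h.1 e (hF he), fun X hX =>
    le_trans (by gcongr) (h.2 X hX)⟩

theorem sym2_union_subset (X Y : Finset V) : X.sym2 ∪ Y.sym2 ⊆ (X ∪ Y).sym2 :=
  Finset.union_subset (Finset.sym2_mono Finset.subset_union_left)
    (Finset.sym2_mono Finset.subset_union_right)

theorem sym2_inter_subset (X Y : Finset V) : X.sym2 ∩ Y.sym2 ⊆ (X ∩ Y).sym2 := by
  intro e he
  rw [Finset.mem_inter, Finset.mem_sym2_iff, Finset.mem_sym2_iff] at he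
  exact Finset.mem_sym2_iff.2 fun a ha => Finset.mem_inter.2 ⟨he.1 a ha, he.2 a ha⟩

/-- Two tight sets with at least two common vertices have a tight union. -/
theorem Sparse.tight_union (h : Sparse E) (hX : 2 * X.card ≤ (E ∩ X.sym2).card + 3)
    (hY : 2 * Y.card ≤ (E ∩ Y.sym2).card + 3) (hXY : 2 ≤ (X ∩ Y).card) :
    2 * (X ∪ Y).card ≤ (E ∩ (X ∪ Y).sym2).card + 3 := by
  -- Induced edge counts are supermodular, while the sparsity bound at `X ∩ Y` limits the loss.
  have h1 := Finset.card_union_add_card_inter (E ∩ X.sym2) (E ∩ Y.sym2)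
  have h2 := Finset.card_union_add_card_inter X Y
  have h3 := h.2 _ hXY
  have h4 : (E ∩ X.sym2 ∪ E ∩ Y.sym2).card ≤ (E ∩ (X ∪ Y).sym2).card := by
    rw [← Finset.inter_union_distrib_left]
    exact Finset.card_le_card (Finset.inter_subset_inter_left (sym2_union_subset X Y))
  have h5 : ((E ∩ X.sym2) ∩ (E ∩ Y.sym2)).card ≤ (E ∩ (X ∩ Y).sym2).card := by
    rw [← Finset.inter_inter_distrib_left]
    exact Finset.card_le_card (Finset.inter_subset_inter_left (sym2_inter_subset X Y))
  omega

/-- A common edge would have both ends in `X ∩ Y`, hence be a loop. -/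
theorem Sparse.disjoint_of_card_inter_le (h : Sparse E) (hXY : (X ∩ Y).card ≤ 1) :
    Disjoint (E ∩ X.sym2) (E ∩ Y.sym2) := by
  rw [Finset.disjoint_left]
  intro e he1 he2
  rw [Finset.mem_inter] at he1 he2
  have := sym2_inter_subset X Y (Finset.mem_inter.2 ⟨he1.2, he2.2⟩)
  have hd := h.1 e he1.1
  induction e with
  | h i j =>
    rw [Finset.mk_mem_sym2_iff] at this
    exact hd (Sym2.mk_isDiag_iff.2 (Finset.card_le_one.1 hXY i this.1 j this.2))

/-- Three tight sets covering the three pairs from `a, b, c` give a tight set containing all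
three. -/
theorem Sparse.exists_tight_of_pairs (h : Sparse E) {a b c : V} (hac : a ≠ c)
    (hX : 2 * X.card ≤ (E ∩ X.sym2).card + 3) (haX : a ∈ X) (hbX : b ∈ X)
    (hY : 2 * Y.card ≤ (E ∩ Y.sym2).card + 3) (hbY : b ∈ Y) (hcY : c ∈ Y)
    (hZ : 2 * Z.card ≤ (E ∩ Z.sym2).card + 3) (haZ : a ∈ Z) (hcZ : c ∈ Z) :
    ∃ W ⊆ X ∪ Y ∪ Z, a ∈ W ∧ b ∈ W ∧ c ∈ W ∧ 2 * W.card ≤ (E ∩ W.sym2).card + 3 := by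
  by_cases h1 : 2 ≤ (X ∩ Y).card
  · exact ⟨X ∪ Y, by grind, by simp [haX], by simp [hbX], by simp [hcY], h.tight_union hX hY h1⟩
  by_cases h2 : 2 ≤ (X ∩ Z).card
  · exact ⟨X ∪ Z, by grind, by simp [haX], by simp [hbX], by simp [hcZ], h.tight_union hX hZ h2⟩
  by_cases h3 : 2 ≤ (Y ∩ Z).card
  · exact ⟨Y ∪ Z, by grind, by simp [haZ], by simp [hbY], by simp [hcZ], h.tight_union hY hZ h3⟩
  -- Now the three edge sets are disjoint, with at least `2 * (X.card + Y.card + Z.card) - 9` edges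
  -- in all, while the union has at most `X.card + Y.card + Z.card - 3` vertices.
  refine ⟨X ∪ Y ∪ Z, subset_rfl, by simp [haX], by simp [hbX], by simp [hcY], ?_⟩
  have d1 := h.disjoint_of_card_inter_le (X := X) (Y := Y) (by omega)
  have d2 := h.disjoint_of_card_inter_le (X := X) (Y := Z) (by omega)
  have d3 := h.disjoint_of_card_inter_le (X := Y) (Y := Z) (by omega)
  have e1 := Finset.card_union_of_disjoint d1
  have e2 := Finset.card_union_of_disjoint (Finset.disjoint_union_left.2 ⟨d2, d3⟩)
  have e3 : (E ∩ X.sym2 ∪ E ∩ Y.sym2 ∪ E ∩ Z.sym2).card ≤ (E ∩ (X ∪ Y ∪ Z).sym2).card := by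
    rw [← Finset.inter_union_distrib_left, ← Finset.inter_union_distrib_left]
    refine Finset.card_le_card (Finset.inter_subset_inter_left ?_)
    exact (Finset.union_subset_union_left (sym2_union_subset X Y)).trans (sym2_union_subset _ _)
  have c1 := Finset.card_union_add_card_inter X Y
  have c2 := Finset.card_union_add_card_inter (X ∪ Y) Z
  have c3 : 1 ≤ (X ∩ Y).card := Finset.card_pos.2 ⟨b, Finset.mem_inter.2 ⟨hbX, hbY⟩⟩
  have c4 : 2 ≤ ((X ∪ Y) ∩ Z).card :=
    Finset.one_lt_card.2 ⟨a, by simp [haX, haZ], c, by simp [hcY, hcZ], hac⟩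
  omega

/-- If a pair `a, b` cannot be added to a sparse set of edges avoiding `v`, it lies in a tight
set avoiding `v`. -/
theorem Sparse.exists_tight_of_not_insert (h : Sparse E) {v a b : V} (hab : a ≠ b) (hav : a ≠ v)
    (hbv : b ≠ v) (hv : ∀ e ∈ E, v ∉ e) (hn : ¬ (s(a, b) ∉ E ∧ Sparse (insert s(a, b) E))) :
    ∃ X : Finset V, v ∉ X ∧ a ∈ X ∧ b ∈ X ∧ 2 * X.card ≤ (E ∩ X.sym2).card + 3 := by
  by_cases hE : s(a, b) ∈ E
  -- The ends of an existing edge form a tight set: `2 * 2 = 1 + 3`.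
  · refine ⟨{a, b}, by simp [hav.symm, hbv.symm], by simp, by simp, ?_⟩
    have : 0 < (E ∩ ({a, b} : Finset V).sym2).card :=
      Finset.card_pos.2 ⟨s(a, b), by simp [hE]⟩
    rw [Finset.card_pair hab]
    omega
  · have : ∃ X : Finset V, 2 ≤ X.card ∧ 2 * X.card < (insert s(a, b) E ∩ X.sym2).card + 3 := by
      by_contra! hX
      refine hn ⟨hE, ?_, hX⟩
      intro e he
      rcases Finset.mem_insert.1 he with rfl | he
      · simpa using hab
      · exact h.1 e he
    obtain ⟨X, hX2, hX⟩ := this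
    have hs := h.2 X hX2
    -- The violating set must contain the new edge, so without that edge it is tight.
    have hmem : s(a, b) ∈ X.sym2 := by
      by_contra hmem
      rw [Finset.insert_inter_of_notMem hmem] at hX
      omega
    rw [Finset.insert_inter_of_mem hmem, Finset.card_insert_of_notMem (by simp [hE])] at hX
    rw [Finset.mk_mem_sym2_iff] at hmem
    refine ⟨X, fun hvX => ?_, hmem.1, hmem.2, by omega⟩
    -- No edge meets `v`, so erasing it from a tight set would leave too many edges.
    have hsub : E ∩ X.sym2 ⊆ E ∩ (X.erase v).sym2 := by
      intro e he
      rw [Finset.mem_inter, Finset.mem_sym2_iff] at he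
      refine Finset.mem_inter.2 ⟨he.1, Finset.mem_sym2_iff.2 fun x hx => ?_⟩
      exact Finset.mem_erase.2 ⟨fun hxv => hv e he.1 (hxv ▸ hx), he.2 x hx⟩
    have h1 := Finset.card_le_card hsub
    have h2 : 2 ≤ (X.erase v).card := Finset.one_lt_card.2
      ⟨a, Finset.mem_erase.2 ⟨hav, hmem.1⟩, b, Finset.mem_erase.2 ⟨hbv, hmem.2⟩, hab⟩
    have h3 := h.2 _ h2
    rw [Finset.card_erase_of_mem hvX] at h3 h2
    omega

/-- At a vertex with exactly three neighbours, some pair of neighbours can be joined after the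
vertex has been removed. -/
theorem Sparse.exists_insert {v a b c : V} (hab : a ≠ b) (hac : a ≠ c) (hbc : b ≠ c)
    (hav : a ≠ v) (hbv : b ≠ v) (hcv : c ≠ v) (hv : ∀ e ∈ F, v ∉ e)
    (h : Sparse (F ∪ {s(v, a), s(v, b), s(v, c)})) :
    (s(a, b) ∉ F ∧ Sparse (insert s(a, b) F)) ∨ (s(b, c) ∉ F ∧ Sparse (insert s(b, c) F)) ∨
      (s(a, c) ∉ F ∧ Sparse (insert s(a, c) F)) := by
  have hF : Sparse F := h.mono Finset.subset_union_left
  by_contra! hno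
  obtain ⟨n1, n2, n3⟩ := hno
  obtain ⟨X, hvX, haX, hbX, hX⟩ :=
    hF.exists_tight_of_not_insert hab hav hbv hv (fun hh => n1 hh.1 hh.2)
  obtain ⟨Y, hvY, hbY, hcY, hY⟩ :=
    hF.exists_tight_of_not_insert hbc hbv hcv hv (fun hh => n2 hh.1 hh.2)
  obtain ⟨Z, hvZ, haZ, hcZ, hZ⟩ :=
    hF.exists_tight_of_not_insert hac hav hcv hv (fun hh => n3 hh.1 hh.2)
  obtain ⟨W, hW, haW, hbW, hcW, ht⟩ :=
    hF.exists_tight_of_pairs hac hX haX hbX hY hbY hcY hZ haZ hcZ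
  have hvW : v ∉ W := fun hh => by
    have := hW hh
    simp [hvX, hvY, hvZ] at this
  -- Adding `v` to the tight set `W` brings three edges for one vertex, which exceeds the sparsity
  -- bound.
  have h2 : 2 ≤ (insert v W).card := Finset.one_lt_card.2 ⟨a, by simp [haW], b, by simp [hbW], hab⟩
  have h3 := h.2 _ h2
  rw [Finset.card_insert_of_notMem hvW] at h3
  have hsub : (F ∩ W.sym2) ∪ {s(v, a), s(v, b), s(v, c)} ⊆
      (F ∪ {s(v, a), s(v, b), s(v, c)}) ∩ (insert v W).sym2 := by
    apply Finset.union_subset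
    · exact Finset.inter_subset_inter Finset.subset_union_left
        (Finset.sym2_mono (Finset.subset_insert _ _))
    · intro e he
      refine Finset.mem_inter.2 ⟨Finset.mem_union_right _ he, ?_⟩
      simp only [Finset.mem_insert, Finset.mem_singleton] at he
      rcases he with rfl | rfl | rfl <;> simp [haW, hbW, hcW]
  have h4 := Finset.card_le_card hsub
  rw [Finset.card_union_of_disjoint] at h4
  · have : ({s(v, a), s(v, b), s(v, c)} : Finset (Sym2 V)).card = 3 := by
      refine Finset.card_eq_three.2 ⟨_, _, _, ?_, ?_, ?_, rfl⟩ <;> simp [hab, hac, hbc, hav, hbv]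
    omega
  · rw [Finset.disjoint_right]
    intro e he he'
    have := hv e (Finset.mem_inter.1 he').1
    simp only [Finset.mem_insert, Finset.mem_singleton] at he
    rcases he with rfl | rfl | rfl <;> simp at this

/-- A nonempty sparse set of edges has a vertex with one, two or three incident edges. -/
theorem Sparse.exists_low_degree [Fintype V] (h : Sparse E) (hE : E.Nonempty) :
    ∃ v, 1 ≤ (E.filter (v ∈ ·)).card ∧ (E.filter (v ∈ ·)).card ≤ 3 := by
  -- Only non-isolated vertices count. Their degrees sum to `2 * E.card ≤ 4 * X.card - 6`, so some
  -- degree is below 4.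
  let X : Finset V := Finset.univ.filter fun v => ∃ e ∈ E, v ∈ e
  have hEX : E ∩ X.sym2 = E := by
    refine Finset.inter_eq_left.2 fun e he => Finset.mem_sym2_iff.2 fun a ha => ?_
    simp only [X, Finset.mem_filter, Finset.mem_univ, true_and]
    exact ⟨e, he, ha⟩
  have hX2 : 2 ≤ X.card := by
    obtain ⟨e, he⟩ := hE
    rw [← Sym2.card_toFinset_of_not_isDiag e (h.1 e he)]
    refine Finset.card_le_card fun a ha => ?_
    simp only [X, Finset.mem_filter, Finset.mem_univ, true_and]
    exact ⟨e, he, Sym2.mem_toFinset.1 ha⟩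
  have hs := h.2 X hX2
  rw [hEX] at hs
  have hsum : ∑ v ∈ X, (E.filter (v ∈ ·)).card = 2 * E.card := by
    have := Finset.sum_card_bipartiteAbove_eq_sum_card_bipartiteBelow
      (s := X) (t := E) (fun v e => v ∈ e)
    simp only [Finset.bipartiteAbove, Finset.bipartiteBelow] at this
    rw [this, Finset.sum_const_nat (m := 2), mul_comm]
    intro e he
    rw [← Sym2.card_toFinset_of_not_isDiag e (h.1 e he)]
    congr 1
    ext a
    simp only [X, Finset.mem_filter, Finset.mem_univ, true_and, Sym2.mem_toFinset]
    exact ⟨fun ha => ha.2, fun ha => ⟨⟨e, he, ha⟩, ha⟩⟩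
  obtain ⟨v, hvX, hv⟩ : ∃ v ∈ X, (E.filter (v ∈ ·)).card < 4 := by
    apply Finset.exists_lt_of_sum_lt
    rw [hsum, Finset.sum_const, smul_eq_mul]
    omega
  refine ⟨v, ?_, by omega⟩
  simp only [X, Finset.mem_filter, Finset.mem_univ, true_and] at hvX
  obtain ⟨e, he, hve⟩ := hvX
  exact Finset.card_pos.2 ⟨e, Finset.mem_filter.2 ⟨he, hve⟩⟩

end Sparse

end PlanarRigidity

namespace PlanarRigidity

variable {n : ℕ} {p : Config n}

/-! ### General position -/

/-- No three points of the configuration lie on a line. -/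
def InGeneralPosition (p : Config n) : Prop :=
  ∀ i j k, i ≠ j → i ≠ k → j ≠ k → cross (p j - p i) (p k - p i) ≠ 0

theorem InGeneralPosition.injective (hn : 3 ≤ n) (h : InGeneralPosition p) :
    Function.Injective p := by
  intro i j hij
  by_contra hne
  obtain ⟨k, hk⟩ : ∃ k, k ∉ ({i, j} : Finset (Fin n)) := by
    by_contra! hall
    have h1 : Finset.univ ⊆ ({i, j} : Finset (Fin n)) := fun k _ => hall k
    have h2 := Finset.card_le_card h1
    have h3 := Finset.card_le_two (a := i) (b := j)
    rw [Finset.card_fin] at h2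
    omega
  simp only [Finset.mem_insert, Finset.mem_singleton, not_or] at hk
  exact h i j k hne (Ne.symm hk.1) (Ne.symm hk.2) (by simp [hij, cross])

theorem eventually_quadratic_ne_zero {a b c : ℝ} (hc : c ≠ 0) :
    ∀ᶠ t : ℝ in 𝓝[≠] 0, a + b * t + c * t ^ 2 ≠ 0 := by
  open Polynomial in
  let P : ℝ[X] := C c * X ^ 2 + C b * X + C a
  have hP : P ≠ 0 := by
    intro h
    have := congrArg (fun Q : ℝ[X] => Q.coeff 2) h
    simp [P, hc] at this
  have hfin : {t : ℝ | P.IsRoot t}.Finite := Polynomial.finite_setOfPred_isRoot hP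
  have := nhdsNE_le_cofinite (0 : ℝ) hfin.compl_mem_cofinite
  filter_upwards [this] with t ht h0
  refine ht ?_
  simp only [Set.mem_ofPred_eq, Polynomial.IsRoot, P, Polynomial.eval_add, Polynomial.eval_mul,
    Polynomial.eval_C, Polynomial.eval_pow, Polynomial.eval_X]
  linarith

/-- Points on a parabola. -/
noncomputable def parabola (n : ℕ) : Config n := fun i => !₂[(i : ℝ), (i : ℝ) ^ 2]

/-- Each collinearity determinant is quadratic in `t`, and its leading coefficient is a Vandermonde
product of the distinct abscissae on the parabola. -/
theorem eventually_inGeneralPosition (p : Config n) :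
    ∀ᶠ t : ℝ in 𝓝[≠] 0, InGeneralPosition (p + t • parabola n) := by
  simp only [InGeneralPosition]
  rw [Filter.eventually_all]; intro i
  rw [Filter.eventually_all]; intro j
  rw [Filter.eventually_all]; intro k
  by_cases h : i ≠ j ∧ i ≠ k ∧ j ≠ k
  · obtain ⟨hij, hik, hjk⟩ := h
    have hne : ∀ {a b : Fin n}, a ≠ b → (b : ℝ) - (a : ℝ) ≠ 0 := fun hab h0 =>
      hab (Fin.ext (by exact_mod_cast (sub_eq_zero.1 h0).symm))
    have hc : cross (parabola n j - parabola n i) (parabola n k - parabola n i) ≠ 0 := by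
      have : cross (parabola n j - parabola n i) (parabola n k - parabola n i) =
          ((j : ℝ) - i) * ((k : ℝ) - i) * ((k : ℝ) - j) := by
        simp [cross, parabola]; ring
      rw [this]
      exact mul_ne_zero (mul_ne_zero (hne hij) (hne hik)) (hne hjk)
    filter_upwards [eventually_quadratic_ne_zero (a := cross (p j - p i) (p k - p i))
      (b := cross (p j - p i) (parabola n k - parabola n i) +
        cross (parabola n j - parabola n i) (p k - p i)) hc] with t ht _ _ _ h0
    apply ht
    rw [← h0]
    simp only [cross, Pi.add_apply, Pi.smul_apply, PiLp.add_apply, PiLp.sub_apply,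
      PiLp.smul_apply, smul_eq_mul]
    ring
  · exact Filter.Eventually.of_forall fun t h1 h2 h3 => absurd ⟨h1, h2, h3⟩ h

theorem row_add_smul (p m : Config n) (t : ℝ) (e : Sym2 (Fin n)) :
    row (p + t • m) e = row p e + t • row m e := by
  induction e with
  | h i j =>
    refine LinearMap.ext fun v => ?_
    rw [LinearMap.add_apply, LinearMap.smul_apply, row_mk, row_mk, row_mk]
    simp [cross]
    ring

/-- Independence of rows is stable under small perturbations. -/
theorem eventually_linearIndepOn {E : Finset (Sym2 (Fin n))} (m : Config n)
    (h : LinearIndepOn ℝ (row p) (E : Set _)) :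
    ∀ᶠ t : ℝ in 𝓝 0, LinearIndepOn ℝ (row (p + t • m)) (E : Set _) := by
  -- Passing to continuous functionals gives the dual a norm, where linear independence is an open
  -- condition.
  let L : Module.Dual ℝ (Config n) ≃ₗ[ℝ] (Config n →L[ℝ] ℝ) := LinearMap.toContinuousLinearMap
  have key : ∀ q : Config n, LinearIndepOn ℝ (row q) (E : Set _) ↔
      LinearIndependent ℝ (fun e : (E : Set (Sym2 (Fin n))) => L (row q e)) := fun q =>
    (LinearMap.linearIndependent_iff L.toLinearMap (LinearEquiv.ker L)).symm
  have hcont : Continuous fun t : ℝ => fun e : (E : Set (Sym2 (Fin n))) =>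
      L (row (p + t • m) e) := by
    refine continuous_pi fun e => ?_
    simp only [row_add_smul, map_add, map_smul]
    fun_prop
  have hopen := (isOpen_setOfPred_linearIndependent (𝕜 := ℝ)
    (ι := (E : Set (Sym2 (Fin n)))) (E := Config n →L[ℝ] ℝ)).preimage hcont
  refine Filter.mem_of_superset (hopen.mem_nhds ?_) fun t ht => (key _).2 ht
  have h0 : p + (0 : ℝ) • m = p := by simp
  simpa [h0] using (key p).1 h

theorem exists_inGeneralPosition {E : Finset (Sym2 (Fin n))}
    (h : LinearIndepOn ℝ (row p) (E : Set _)) :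
    ∃ q : Config n, InGeneralPosition q ∧ LinearIndepOn ℝ (row q) (E : Set _) := by
  obtain ⟨t, h1, h2⟩ := ((eventually_inGeneralPosition p).and
    ((eventually_linearIndepOn (parabola n) h).filter_mono nhdsWithin_le_nhds)).exists
  exact ⟨_, h1, h2⟩

/-! ### Vertex extensions -/

theorem row_single_of_notMem {e : Sym2 (Fin n)} {v : Fin n} (hv : v ∉ e) (x : Plane) :
    row p e (Pi.single v x) = 0 := by
  induction e with
  | h i j =>
    simp only [Sym2.mem_iff, not_or] at hv
    rw [row_mk, Pi.single_eq_of_ne (Ne.symm hv.1), Pi.single_eq_of_ne (Ne.symm hv.2)]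
    simp [cross]

theorem row_single_of_ne {v a : Fin n} (h : a ≠ v) (x : Plane) :
    row p s(v, a) (Pi.single v x) = cross (p v - p a) x := by
  rw [row_mk, Pi.single_eq_same, Pi.single_eq_of_ne h, sub_zero]

theorem row_update_of_notMem {e : Sym2 (Fin n)} {v : Fin n} (hv : v ∉ e) (x : Plane) :
    row (Function.update p v x) e = row p e := by
  induction e with
  | h i j =>
    simp only [Sym2.mem_iff, not_or] at hv
    refine LinearMap.ext fun w => ?_
    rw [row_mk, row_mk, Function.update_of_ne (Ne.symm hv.1), Function.update_of_ne (Ne.symm hv.2)]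

/-- Splitting a linear relation between rows at a vertex. -/
theorem sum_row_union {F : Finset (Sym2 (Fin n))} {v : Fin n} (hF : ∀ e ∈ F, v ∉ e)
    (N : Finset (Fin n)) (f : Sym2 (Fin n) → ℝ) :
    ∑ e ∈ F ∪ N.image (fun a => s(v, a)), f e • row p e =
      ∑ e ∈ F, f e • row p e + ∑ a ∈ N, f s(v, a) • row p s(v, a) := by
  rw [Finset.sum_union, Finset.sum_image]
  · intro a _ b _ hab
    exact Sym2.congr_right.1 hab
  · rw [Finset.disjoint_right]
    intro e he he'
    obtain ⟨a, -, rfl⟩ := Finset.mem_image.1 he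
    exact hF _ he' (by simp)

/-- Testing the relation on velocities supported at `v` leaves only the edges at `v`: a balance of
forces there. -/
theorem relation_at_vertex {F : Finset (Sym2 (Fin n))} {v : Fin n} (hF : ∀ e ∈ F, v ∉ e)
    {N : Finset (Fin n)} (hN : v ∉ N) {f : Sym2 (Fin n) → ℝ}
    (h : ∑ e ∈ F, f e • row p e + ∑ a ∈ N, f s(v, a) • row p s(v, a) = 0) (x : Plane) :
    ∑ a ∈ N, f s(v, a) * cross (p v - p a) x = 0 := by
  have := congrArg (fun φ : Module.Dual ℝ (Config n) => φ (Pi.single v x)) h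
  simp only [LinearMap.add_apply, LinearMap.coe_sum, Finset.sum_apply, LinearMap.smul_apply,
    smul_eq_mul, LinearMap.zero_apply] at this
  rw [Finset.sum_eq_zero (fun e he => by rw [row_single_of_notMem (hF e he), mul_zero]),
    zero_add] at this
  rw [← this]
  refine Finset.sum_congr rfl fun a ha => ?_
  rw [row_single_of_ne (ne_of_mem_of_not_mem ha hN)]

/-- Adding a vertex whose edge directions are independent keeps the rows independent. -/
theorem linearIndepOn_union {F : Finset (Sym2 (Fin n))} {v : Fin n} (hF : ∀ e ∈ F, v ∉ e)
    {N : Finset (Fin n)} (hN : v ∉ N) (hI : LinearIndepOn ℝ (row p) (F : Set _))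
    (hloc : ∀ g : Fin n → ℝ, (∀ x, ∑ a ∈ N, g a * cross (p v - p a) x = 0) → ∀ a ∈ N, g a = 0) :
    LinearIndepOn ℝ (row p) ((F ∪ N.image (fun a => s(v, a)) : Finset _) : Set _) := by
  rw [linearIndepOn_finset_iff] at hI ⊢
  intro f hf
  rw [sum_row_union hF] at hf
  have h0 := hloc (fun a => f s(v, a)) (relation_at_vertex hF hN hf)
  rw [Finset.sum_eq_zero (s := N) (fun a ha => by rw [h0 a ha, zero_smul]), add_zero] at hf
  intro e he
  rcases Finset.mem_union.1 he with he | he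
  · exact hI f hf e he
  · obtain ⟨a, ha, rfl⟩ := Finset.mem_image.1 he
    exact h0 a ha

theorem cross_self (x : Plane) : cross x x = 0 := by simp [cross]; ring

theorem exists_cross_ne_zero {x : Plane} (hx : x ≠ 0) : ∃ y, cross x y ≠ 0 := by
  refine ⟨perp x, ?_⟩
  have : cross x (perp x) = ‖x‖ ^ 2 := by rw [norm_sq_coord]; simp [cross]; ring
  rw [this]
  exact pow_ne_zero 2 (norm_ne_zero_iff.2 hx)

/-- The first Henneberg move: in general position one or two edge directions at `v` are independent,
so no relation can involve the new edges. -/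
theorem InGeneralPosition.linearIndepOn_vertex (hn : 3 ≤ n) (hp : InGeneralPosition p)
    {F : Finset (Sym2 (Fin n))} {v : Fin n} (hF : ∀ e ∈ F, v ∉ e)
    {N : Finset (Fin n)} (hN : v ∉ N) (hI : LinearIndepOn ℝ (row p) (F : Set _))
    (h1 : 1 ≤ N.card) (h2 : N.card ≤ 2) :
    LinearIndepOn ℝ (row p) ((F ∪ N.image (fun a => s(v, a)) : Finset _) : Set _) := by
  refine linearIndepOn_union hF hN hI fun g hg => ?_
  have : N.card = 1 ∨ N.card = 2 := by omega
  rcases this with hc | hc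
  · obtain ⟨a, rfl⟩ := Finset.card_eq_one.1 hc
    rw [Finset.mem_singleton] at hN
    obtain ⟨x, hx⟩ := exists_cross_ne_zero (sub_ne_zero.2 ((hp.injective hn).ne hN))
    have := hg x
    rw [Finset.sum_singleton] at this
    simpa [hx] using this
  · obtain ⟨a, b, hab, rfl⟩ := Finset.card_eq_two.1 hc
    simp only [Finset.mem_insert, Finset.mem_singleton, not_or] at hN
    have hne := hp v a b hN.1 hN.2 hab
    simp only [Finset.sum_pair hab] at hg
    have ha : cross (p v - p a) (p v - p b) ≠ 0 := by
      convert hne using 1; simp [cross]; ring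
    have hb : cross (p v - p b) (p v - p a) ≠ 0 := by
      intro h0; apply ha; simp only [cross] at h0 ⊢; linarith
    -- Testing along one edge direction eliminates the coefficient of that edge.
    have ea := hg (p v - p b)
    have eb := hg (p v - p a)
    rw [cross_self, mul_zero, add_zero] at ea
    rw [cross_self, mul_zero, zero_add] at eb
    simp only [Finset.mem_insert, Finset.mem_singleton]
    rintro c (rfl | rfl)
    · exact (mul_eq_zero.1 ea).resolve_right ha
    · exact (mul_eq_zero.1 eb).resolve_right hb

/-- Subdividing the edge `a b` by its midpoint `v` and joining `v` to `c` keeps the rows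
independent. -/
theorem InGeneralPosition.linearIndepOn_subdivide (hp : InGeneralPosition p)
    (hinj : Function.Injective p)
    {F : Finset (Sym2 (Fin n))} {v a b c : Fin n} (hF : ∀ e ∈ F, v ∉ e)
    (hab : a ≠ b) (hac : a ≠ c) (hbc : b ≠ c) (hav : a ≠ v) (hbv : b ≠ v) (hcv : c ≠ v)
    (habF : s(a, b) ∉ F)
    (hI : LinearIndepOn ℝ (row p) ((insert s(a, b) F : Finset _) : Set _)) :
    LinearIndepOn ℝ (row (Function.update p v ((1 / 2 : ℝ) • (p a + p b))))
      ((F ∪ ({a, b, c} : Finset _).image (fun a => s(v, a)) : Finset _) : Set _) := by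
  set q := Function.update p v ((1 / 2 : ℝ) • (p a + p b)) with hq
  have qv : q v = (1 / 2 : ℝ) • (p a + p b) := Function.update_self ..
  have qa : q a = p a := Function.update_of_ne hav ..
  have qb : q b = p b := Function.update_of_ne hbv ..
  have qc : q c = p c := Function.update_of_ne hcv ..
  have hrow : ∀ e ∈ F, row q e = row p e := fun e he => row_update_of_notMem (hF e he) _
  rw [linearIndepOn_finset_iff] at hI ⊢
  intro f hf
  rw [sum_row_union hF] at hf
  have hloc := relation_at_vertex hF (by simp [hav.symm, hbv.symm, hcv.symm]) hf
  have hsum : ∀ {M : Type} [AddCommMonoid M] (g : Fin n → M),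
      ∑ i ∈ ({a, b, c} : Finset (Fin n)), g i = g a + (g b + g c) := by
    intro M _ g
    rw [Finset.sum_insert (by simp [hab, hac]), Finset.sum_pair hbc]
  rw [hsum] at hf
  simp only [hsum] at hloc
  rw [qv, qa, qb, qc] at hloc
  -- Testing along the line `ab`, which contains `v`, leaves only the force towards `c`.
  have hfc : f s(v, c) = 0 := by
    have h1 := hloc (p b - p a)
    have h2 := hp a b c hab hac hbc
    refine (mul_eq_zero.1 ?_).resolve_right h2
    simp only [cross, PiLp.sub_apply, PiLp.smul_apply, PiLp.add_apply, smul_eq_mul] at h1 ⊢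
    linear_combination h1
  -- The remaining two forces are along opposite vectors of equal length, so their coefficients
  -- agree.
  have hfab : f s(v, a) = f s(v, b) := by
    obtain ⟨x, hx⟩ := exists_cross_ne_zero (sub_ne_zero.2 (hinj.ne hab))
    have h1 := hloc x
    rw [hfc] at h1
    refine sub_eq_zero.1 ((mul_eq_zero.1 ?_).resolve_right hx)
    simp only [cross, PiLp.sub_apply, PiLp.smul_apply, PiLp.add_apply, smul_eq_mul] at h1 ⊢
    linear_combination -2 * h1
  -- The velocity of `v` cancels, so the two halves together act as half of the edge `ab`; the
  -- relation becomes one among the rows of `insert s(a, b) F` at `p`.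
  have hmid : row q s(v, a) + row q s(v, b) = (1 / 2 : ℝ) • row p s(a, b) := by
    refine LinearMap.ext fun w => ?_
    rw [LinearMap.add_apply, LinearMap.smul_apply, row_mk, row_mk, row_mk, qv, qa, qb]
    simp [cross]
    ring
  rw [hfc, zero_smul, add_zero, hfab, ← smul_add, hmid, smul_smul,
    Finset.sum_congr rfl fun e he => by rw [hrow e he]] at hf
  have hF0 := hI (Function.update f s(a, b) (f s(v, b) * (1 / 2))) (by
    rw [Finset.sum_insert habF, Function.update_self, ← hf, add_comm]
    congr 1
    refine Finset.sum_congr rfl fun e he => ?_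
    rw [Function.update_of_ne (ne_of_mem_of_not_mem he habF)])
  have hb0 : f s(v, b) = 0 := by
    have := hF0 s(a, b) (Finset.mem_insert_self _ _)
    rw [Function.update_self] at this
    linarith
  intro e he
  rcases Finset.mem_union.1 he with he | he
  · have := hF0 e (Finset.mem_insert_of_mem he)
    rwa [Function.update_of_ne (ne_of_mem_of_not_mem he habF)] at this
  · simp only [Finset.mem_image, Finset.mem_insert, Finset.mem_singleton] at he
    obtain ⟨x, (rfl | rfl | rfl), rfl⟩ := he
    · rw [hfab, hb0]
    · exact hb0
    · exact hfc

/-- Laman's theorem: a sparse set of edges has independent rows at some configuration. -/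
theorem Sparse.exists_linearIndepOn (hn : 3 ≤ n) (E : Finset (Sym2 (Fin n))) (hE : Sparse E) :
    ∃ p : Config n, InGeneralPosition p ∧ LinearIndepOn ℝ (row p) (E : Set _) := by
  -- The induction is on edges; the vertex set stays `Fin n`, with removed vertices merely isolated.
  -- In degree 3 the trade lowers the edge count by 2.
  induction hk : E.card using Nat.strong_induction_on generalizing E with
  | _ k ih =>
  subst hk
  rcases E.eq_empty_or_nonempty with rfl | hne
  · exact exists_inGeneralPosition (p := 0) (by simp)
  obtain ⟨v, h1, h3⟩ := hE.exists_low_degree hne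
  set F := E.filter (v ∉ ·) with hFdef
  set N : Finset (Fin n) := Finset.univ.filter (fun a => s(v, a) ∈ E) with hNdef
  have hF : ∀ e ∈ F, v ∉ e := fun e he => (Finset.mem_filter.1 he).2
  have hvN : v ∉ N := fun h => hE.1 _ (Finset.mem_filter.1 h).2 (by simp)
  have himg : E.filter (v ∈ ·) = N.image (fun a => s(v, a)) := by
    ext e
    simp only [Finset.mem_filter, Finset.mem_image, hNdef, Finset.mem_univ, true_and]
    constructor
    · rintro ⟨he, hve⟩
      obtain ⟨a, rfl⟩ := Sym2.mem_iff_exists.1 hve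
      exact ⟨a, he, rfl⟩
    · rintro ⟨a, ha, rfl⟩
      exact ⟨ha, by simp⟩
  have hcard : (E.filter (v ∈ ·)).card = N.card := by
    rw [himg, Finset.card_image_of_injective]
    intro a b hab
    exact Sym2.congr_right.1 hab
  have hunion : E = F ∪ N.image (fun a => s(v, a)) := by
    rw [← himg, hFdef, Finset.union_comm, Finset.filter_union_filter_not_eq]
  have hsplit : N.card + F.card = E.card := by
    rw [← hcard, hFdef, Finset.card_filter_add_card_filter_not]
  rw [hcard] at h1 h3
  by_cases hN2 : N.card ≤ 2
  · obtain ⟨p, hp, hI⟩ := ih F.card (by omega) F (hE.mono (Finset.filter_subset _ _)) rfl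
    refine ⟨p, hp, ?_⟩
    rw [hunion]
    exact hp.linearIndepOn_vertex hn hF hvN hI h1 hN2
  have key : ∀ a b c : Fin n, N = {a, b, c} → a ≠ b → a ≠ c → b ≠ c → s(a, b) ∉ F →
      Sparse (insert s(a, b) F) →
      ∃ p : Config n, InGeneralPosition p ∧ LinearIndepOn ℝ (row p) (E : Set _) := by
    intro a b c hN hab hac hbc habF hs
    rw [hN] at hvN
    simp only [Finset.mem_insert, Finset.mem_singleton, not_or] at hvN
    have hc := Finset.card_insert_of_notMem habF
    obtain ⟨p, hp, hI⟩ := ih (insert s(a, b) F).card (by omega) _ hs rfl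
    have := hp.linearIndepOn_subdivide (hp.injective hn) hF hab hac hbc (Ne.symm hvN.1)
      (Ne.symm hvN.2.1) (Ne.symm hvN.2.2) habF hI
    rw [← hN, ← hunion] at this
    -- The midpoint is collinear with `a` and `b`; a perturbation restores general position for the
    -- induction.
    exact exists_inGeneralPosition this
  obtain ⟨a, b, c, hab, hac, hbc, hN⟩ := Finset.card_eq_three.1 (show N.card = 3 by omega)
  have hvN' := hvN
  rw [hN] at hvN'
  simp only [Finset.mem_insert, Finset.mem_singleton, not_or] at hvN'
  have hE' : Sparse (F ∪ {s(v, a), s(v, b), s(v, c)}) := by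
    rw [hunion, hN] at hE
    simpa [Finset.image_insert] using hE
  rcases Sparse.exists_insert hab hac hbc (Ne.symm hvN'.1) (Ne.symm hvN'.2.1)
    (Ne.symm hvN'.2.2) hF hE' with h | h | h
  · exact key a b c hN hab hac hbc h.1 h.2
  · exact key b c a (by rw [hN]; ext; simp; tauto) hbc hab.symm hac.symm h.1 h.2
  · exact key a c b (by rw [hN]; ext; simp; tauto) hac hab hbc.symm h.1 h.2

end PlanarRigidity

namespace PlanarRigidity

variable {n : ℕ} {G : SimpleGraph (Fin n)} {p : Config n}

/-! ### Laman graphs -/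

/-! ### Edge counts and minimality -/

theorem IsIBR.le_ncard (hn : 3 ≤ n) (hp : Function.Injective p) (h : IsIBR G p) :
    2 * n ≤ G.edgeSet.ncard + 3 := by
  obtain ⟨E, hE, -, hc, -⟩ := h.exists_basis hn hp
  have := Set.ncard_le_ncard hE
  rw [Set.ncard_coe_finset] at this
  omega

/-- A row basis is already a rigid connected spanning subgraph, so minimality leaves no other edge.
All rows of `G` are then independent, and the bound on independent rows gives sparsity. -/
theorem isLamanGraph_of_minimal (hn : 3 ≤ n) (hp : Function.Injective p) (h : IsIBR G p)
    (hmin : ¬ ∃ H : SimpleGraph (Fin n), IsSpanningSubgraph H G ∧ IsIBR H p ∧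
      H.edgeSet.ncard < G.edgeSet.ncard) : IsLamanGraph G := by
  classical
  obtain ⟨E, hE, hli, hc, hI⟩ := h.exists_basis hn hp
  have hle : SimpleGraph.fromEdgeSet (E : Set (Sym2 (Fin n))) ≤ G := by
    intro i j hij
    exact hE ((SimpleGraph.fromEdgeSet_adj _).1 hij).1
  have hcard : (SimpleGraph.fromEdgeSet (E : Set (Sym2 (Fin n)))).edgeSet.ncard ≤ E.card := by
    rw [← Set.ncard_coe_finset]
    refine Set.ncard_le_ncard ?_
    rw [SimpleGraph.edgeSet_fromEdgeSet]
    exact Set.sdiff_subset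
  have hGE : G.edgeSet = E := by
    refine (Set.eq_of_subset_of_ncard_le hE ?_).symm
    rw [Set.ncard_coe_finset]
    by_contra hlt
    exact hmin ⟨_, ⟨hle, hI.connected hn hp⟩, hI, by omega⟩
  refine ⟨hn, by rw [hGE, Set.ncard_coe_finset, hc], fun K hK => ?_⟩
  have hKE : K.edgeSet.toFinset ⊆ K.verts.toFinset.sym2 := by
    intro e he
    rw [Set.mem_toFinset] at he
    refine Finset.mem_sym2_iff.2 fun a ha => ?_
    rw [Set.mem_toFinset]
    exact K.mem_verts_of_mem_edge he ha
  rw [Set.ncard_eq_toFinset_card'] at hK ⊢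
  rw [Set.ncard_eq_toFinset_card']
  refine card_add_three_le hp hK hKE (hli.mono ?_)
  rw [Set.coe_toFinset, ← hGE]
  exact K.edgeSet_subset

theorem IsLamanGraph.exists_sparse (h : IsLamanGraph G) :
    ∃ E : Finset (Sym2 (Fin n)), G.edgeSet = E ∧ Sparse E := by
  classical
  refine ⟨G.edgeSet.toFinset, (Set.coe_toFinset _).symm, fun e he => ?_, fun X hX => ?_⟩
  · exact G.not_isDiag_of_mem_edgeSet (Set.mem_toFinset.1 he)
  -- The induced subgraph has the most edges on `X`, so it gives the sparsity bound.
  · have := h.2.2 ((⊤ : G.Subgraph).induce X) (by simpa [Set.ncard_coe_finset] using hX)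
    rw [SimpleGraph.Subgraph.induce_verts, Set.ncard_coe_finset] at this
    refine le_trans ?_ this
    rw [← Set.ncard_coe_finset]
    refine Nat.add_le_add_right (Set.ncard_le_ncard ?_) 3
    intro e he
    rw [Finset.mem_coe, Finset.mem_inter, Set.mem_toFinset] at he
    induction e with
    | h i j =>
      rw [Finset.mk_mem_sym2_iff] at he
      rw [SimpleGraph.Subgraph.mem_edgeSet, SimpleGraph.Subgraph.induce_adj]
      exact ⟨he.2.1, he.2.2, he.1⟩

theorem IsLamanGraph.exists_isIBR (h : IsLamanGraph G) :
    ∃ p : Config n, Function.Injective p ∧ IsIBR G p := by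
  obtain ⟨E, hGE, hs⟩ := h.exists_sparse
  obtain ⟨p, hp, hli⟩ := hs.exists_linearIndepOn h.1 E
  refine ⟨p, hp.injective h.1, isIBR_of_linearIndepOn h.1 (hp.injective h.1) hGE hli ?_⟩
  rw [← Set.ncard_coe_finset, ← hGE, h.2.1]

variable {Rigid : SimpleGraph (Fin n) → Config n → Prop}

/-- A smaller rigid subgraph may use another configuration `q`. From minimal to Laman the same `p`
suffices; in the converse the edge bound does not depend on the configuration. -/
theorem isMinimallyRigidGraph_iff (hn : 3 ≤ n)
    (hR : ∀ G p, Function.Injective p → (Rigid G p ↔ IsIBR G p)) :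
    IsMinimallyRigidGraph Rigid G ↔ IsLamanGraph G := by
  constructor
  · rintro ⟨⟨p, hp, h⟩, hmin⟩
    refine isLamanGraph_of_minimal hn hp ((hR _ _ hp).1 h) ?_
    rintro ⟨H, hH, hI, hlt⟩
    exact hmin ⟨H, hH, ⟨p, hp, (hR _ _ hp).2 hI⟩, hlt⟩
  · intro h
    obtain ⟨p, hp, hI⟩ := h.exists_isIBR
    refine ⟨⟨p, hp, (hR _ _ hp).2 hI⟩, ?_⟩
    rintro ⟨H, -, ⟨q, hq, hH⟩, hlt⟩
    have := IsIBR.le_ncard hn hq ((hR _ _ hq).1 hH)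
    have := h.2.1
    omega

theorem exists_isMinimallyRigidFramework_iff (hn : 3 ≤ n)
    (hR : ∀ G p, Function.Injective p → (Rigid G p ↔ IsIBR G p)) :
    (∃ p, IsMinimallyRigidFramework Rigid G p) ↔ IsLamanGraph G := by
  constructor
  · rintro ⟨p, hp, h, hmin⟩
    refine isLamanGraph_of_minimal hn hp ((hR _ _ hp).1 h) ?_
    rintro ⟨H, hH, hI, hlt⟩
    exact hmin ⟨H, hH, (hR _ _ hp).2 hI, hlt⟩
  · intro h
    obtain ⟨p, hp, hI⟩ := h.exists_isIBR
    refine ⟨p, hp, (hR _ _ hp).2 hI, ?_⟩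
    rintro ⟨H, -, hH, hlt⟩
    have := IsIBR.le_ncard hn hp ((hR _ _ hp).1 hH)
    have := h.2.1
    omega

end PlanarRigidity

theorem theorem6 {n : ℕ} (hn : 3 ≤ n) (G : SimpleGraph (Fin n)) :
    -- a graph is minimally rigid iff it is Laman
    ((IsMinimallyRigidGraph (OnNondegenerate IsSAR) G ↔ IsLamanGraph G) ∧
      (IsMinimallyRigidGraph IsISAR G ↔ IsLamanGraph G) ∧
      (IsMinimallyRigidGraph (OnNondegenerate IsGSAR) G ↔ IsLamanGraph G) ∧
      (IsMinimallyRigidGraph IsIBR G ↔ IsLamanGraph G) ∧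
      (IsMinimallyRigidGraph (OnNondegenerate IsGBR) G ↔ IsLamanGraph G) ∧
      (IsMinimallyRigidGraph (OnNondegenerate IsBR) G ↔ IsLamanGraph G)) ∧
    -- a graph carries a minimally rigid framework iff it is Laman
    (((∃ p, IsMinimallyRigidFramework (OnNondegenerate IsSAR) G p) ↔ IsLamanGraph G) ∧
      ((∃ p, IsMinimallyRigidFramework IsISAR G p) ↔ IsLamanGraph G) ∧
      ((∃ p, IsMinimallyRigidFramework (OnNondegenerate IsGSAR) G p) ↔ IsLamanGraph G) ∧
      ((∃ p, IsMinimallyRigidFramework IsIBR G p) ↔ IsLamanGraph G) ∧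
      ((∃ p, IsMinimallyRigidFramework (OnNondegenerate IsGBR) G p) ↔ IsLamanGraph G) ∧
      ((∃ p, IsMinimallyRigidFramework (OnNondegenerate IsBR) G p) ↔ IsLamanGraph G)) := by
  have tfae := fun (G : SimpleGraph (Fin n)) p (hp : Function.Injective p) =>
    isIBR_tfae (G := G) hn hp
  have h1 : ∀ G p, Function.Injective p → (OnNondegenerate IsSAR G p ↔ IsIBR G p) :=
    fun G p hp => (tfae G p hp).out 1 0
  have h2 : ∀ (G : SimpleGraph (Fin n)) p, Function.Injective p → (IsISAR G p ↔ IsIBR G p) :=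
    fun G p hp => (tfae G p hp).out 2 0
  have h3 : ∀ G p, Function.Injective p → (OnNondegenerate IsGSAR G p ↔ IsIBR G p) :=
    fun G p hp => (tfae G p hp).out 3 0
  have h4 : ∀ (G : SimpleGraph (Fin n)) p, Function.Injective p → (IsIBR G p ↔ IsIBR G p) :=
    fun _ _ _ => Iff.rfl
  have h5 : ∀ G p, Function.Injective p → (OnNondegenerate IsGBR G p ↔ IsIBR G p) :=
    fun G p hp => (tfae G p hp).out 4 0
  have h6 : ∀ G p, Function.Injective p → (OnNondegenerate IsBR G p ↔ IsIBR G p) :=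
    fun G p hp => (tfae G p hp).out 5 0
  exact ⟨⟨isMinimallyRigidGraph_iff hn h1, isMinimallyRigidGraph_iff hn h2,
      isMinimallyRigidGraph_iff hn h3, isMinimallyRigidGraph_iff hn h4,
      isMinimallyRigidGraph_iff hn h5, isMinimallyRigidGraph_iff hn h6⟩,
    exists_isMinimallyRigidFramework_iff hn h1, exists_isMinimallyRigidFramework_iff hn h2,
    exists_isMinimallyRigidFramework_iff hn h3, exists_isMinimallyRigidFramework_iff hn h4,
    exists_isMinimallyRigidFramework_iff hn h5, exists_isMinimallyRigidFramework_iff hn h6⟩
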